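/- Let $k$ be an algebraically closed field of characteristic zero, and let $R=k[x_0,x_1,x_2]$. A monomial Togliatti system of forms of degree $d$ in $R$ is an artinian ideal $I$ generated by $r\le d+1$ monomials of degree $d$ which fails the weak Lefschetz property in degree $d-1$: for the general (equivalently, for every) linear form $L$, the multiplication map $\times L\colon (R/I)_{d-1}\to (R/I)_d$ is neither injective nor surjective. It is minimal if no proper subset of its set of $d$-ic monomial generators generates a monomial Togliatti system. It is smooth if the projective variety $X$ is smooth, where $X$ is the closure of the image of the rational map from $\mathbb{P}^2$ given by all monomials of degree $d$ not in $I$. Let $\mathcal{T}(2,d)$ be the set of minimal monomial Togliatti systems of forms of degree $d$ in $R$, and $\mathcal{T}^s(2,d)\subset\mathcal{T}(2,d)$ the subset of the smooth ones. Let $\mu(I)$ be the minimal number of generators of $I$, let $\mu(2,d)$ and $\rho(2,d)$ be the minimum and the maximum of $\mu(I)$ over $I\in\mathcal{T}(2,d)$, and let $\mu^s(2,d)$ and $\rho^s(2,d)$ be the minimum and the maximum of $\mu(I)$ over $I\in\mathcal{T}^s(2,d)$. Proposition 4.1. Let $d\ge 4$. Then: (i) $\mu^s(2,d)=\mu(2,d)=5$.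 (ii) $\rho^s(2,d)=\rho(2,d)=d+1$. (iii) For every integer $r$ with $5\le r\le d+1$ there exists $I\in\mathcal{T}^s(2,d)$ with $\mu(I)=r$. Explicitly, one can take $I=I_r$, where $$I_5=(x_0^d,x_1^d,x_2^d)+x_0^{d-1}(x_1,x_2),$$ and, for $r>5$, $$I_r=(x_0^d,x_1^d,x_2^d)+x_0^{d-r+3}x_1x_2\,(x_0^{r-5},\,x_0^{r-6}x_1,\,\dots,\,x_0x_1^{r-6},\,x_1^{r-5},\,x_2^{r-5}).$$ -/

import Mathlib

noncomputable section

namespace Togliatti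

open MvPolynomial

variable {k : Type*} [Field k] {n : ℕ}

/-! ### The weak Lefschetz property -/

/-- The graded piece `(R/I)_j` of `R/I`, where `R = k[x_0, …, x_n]`: the classes of the forms of
degree `j`. -/
def gradedPiece (I : Ideal (MvPolynomial (Fin (n + 1)) k)) (j : ℕ) :
    Submodule k (MvPolynomial (Fin (n + 1)) k ⧸ I) :=
  (homogeneousSubmodule (Fin (n + 1)) k j).map (Ideal.Quotient.mkₐ k I).toLinearMap

/-- Multiplication by `L`, as a map `(R/I)_j → (R/I)_{j+1}`, is injective or surjective. -/
def HasMaximalRank (I : Ideal (MvPolynomial (Fin (n + 1)) k)) (j : ℕ)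
    (L : MvPolynomial (Fin (n + 1)) k) : Prop :=
  Set.InjOn (fun u => Ideal.Quotient.mk I L * u) (gradedPiece I j : Set _) ∨
    Set.SurjOn (fun u => Ideal.Quotient.mk I L * u)
      (gradedPiece I j : Set _) (gradedPiece I (j + 1) : Set _)

/-- `I` fails the weak Lefschetz property in degree `j`: for no linear form `L` does the map
`×L : (R/I)_j → (R/I)_{j+1}` have maximal rank. (Having maximal rank is an open condition on `L`,
so that this is the same as failure for the general linear form.) -/
def FailsWLP (I : Ideal (MvPolynomial (Fin (n + 1)) k)) (j : ℕ) : Prop :=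
  ∀ L : MvPolynomial (Fin (n + 1)) k, L.IsHomogeneous 1 → ¬ HasMaximalRank I j L

/-! ### Togliatti systems -/

/-- `I` is a Togliatti system of forms of degree `d`: an artinian ideal generated by `r` forms of
degree `d`, with `r ≤ binom (n+d-1) (n-1)`, which fails the weak Lefschetz property in degree
`d - 1`. -/
def IsTogliatti (d : ℕ) (I : Ideal (MvPolynomial (Fin (n + 1)) k)) : Prop :=
  (∃ (r : ℕ) (F : Fin r → MvPolynomial (Fin (n + 1)) k),
    r ≤ (n + d - 1).choose (n - 1) ∧ (∀ i, (F i).IsHomogeneous d) ∧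
      I = Ideal.span (Set.range F)) ∧
  IsArtinianRing (MvPolynomial (Fin (n + 1)) k ⧸ I) ∧
  FailsWLP I (d - 1)

variable (k) in
/-- The ideal generated by the monomials `x^a`, `a ∈ S`. -/
def monomialIdeal (S : Finset (Fin (n + 1) →₀ ℕ)) : Ideal (MvPolynomial (Fin (n + 1)) k) :=
  Ideal.span ((fun a => monomial a (1 : k)) '' (S : Set (Fin (n + 1) →₀ ℕ)))

/-- `I` is a minimal monomial Togliatti system of forms of degree `d`: it is a Togliatti system
generated by a finite set of monomials of degree `d` no proper subset of which generates a
Togliatti system. -/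
def IsMinimalMonomialTogliatti (d : ℕ) (I : Ideal (MvPolynomial (Fin (n + 1)) k)) : Prop :=
  ∃ S : Finset (Fin (n + 1) →₀ ℕ), (∀ a ∈ S, a.degree = d) ∧ I = monomialIdeal k S ∧
    IsTogliatti d I ∧ ∀ T ⊂ S, ¬ IsTogliatti d (monomialIdeal k T)

/-! ### The apolar toric variety and its smoothness -/

open Classical in
/-- The set `A_I` of exponents of the monomials of degree `d` that are not in `I`. For a monomial
ideal `I` these monomials form a basis of the degree `d` part of the inverse system. -/
def apolarExponents (d : ℕ) (I : Ideal (MvPolynomial (Fin (n + 1)) k)) :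
    Finset (Fin (n + 1) →₀ ℕ) :=
  ((Finset.univ : Finset (Fin (n + 1))).finsuppAntidiag d).filter
    fun a => monomial a (1 : k) ∉ I

/-- The map `k^{n+1} → k^A`, `x ↦ (x^a)_{a ∈ A}`. -/
def monomialMap (A : Finset (Fin (n + 1) →₀ ℕ)) (x : Fin (n + 1) → k) : A → k :=
  fun a => ∏ i, x i ^ (a.1 i)

variable (k) in
/-- The vanishing ideal of the image of `monomialMap A`. If all the exponents in `A` have the same
degree `d ≥ 1` (and `k` is algebraically closed), that image is the affine cone over the image of
the rational map `ℙ^n ⇢ ℙ(k^A)` given by the monomials `x^a`, `a ∈ A`, and the ideal is the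
homogeneous ideal of the closure `X_A` of the image of this rational map. -/
def coneIdeal (A : Finset (Fin (n + 1) →₀ ℕ)) : Ideal (MvPolynomial A k) :=
  vanishingIdeal k (Set.range (monomialMap (k := k) A))

/-- The Zariski tangent space at `y` of the affine cone over `X_A`. -/
def tangentSpace (A : Finset (Fin (n + 1) →₀ ℕ)) (y : A → k) : Submodule k (A → k) where
  carrier := {v | ∀ f ∈ coneIdeal k A, ∑ a, eval y (pderiv a f) * v a = 0}
  zero_mem' := by intro f _; simp
  add_mem' := by
    intro v w hv hw f hf
    simp only [Pi.add_apply, mul_add, Finset.sum_add_distrib]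
    rw [hv f hf, hw f hf, add_zero]
  smul_mem' := by
    intro c v hv f hf
    have h := congrArg (c * ·) (hv f hf)
    simpa [Finset.mul_sum, mul_left_comm] using h

variable (k) in
/-- The projective variety `X_A ⊆ ℙ(k^A)` is smooth (Jacobian criterion): at every nonzero point
of the affine cone over `X_A`, i.e. at every representative of every point of `X_A`, the Zariski
tangent space of the cone has the dimension of the cone (`dim X_A + 1`), which is the transcendence
degree over `k` of the homogeneous coordinate ring of `X_A`. -/
def IsSmoothToric (A : Finset (Fin (n + 1) →₀ ℕ)) : Prop :=
  ∀ y ∈ zeroLocus k (coneIdeal k A), y ≠ 0 →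
    Module.rank k (tangentSpace A y) = Algebra.trdeg k (MvPolynomial A k ⧸ coneIdeal k A)

/-! ### The sets of systems, and the explicit examples -/

variable (k n) in
/-- The set `𝒯(n,d)` of minimal monomial Togliatti systems of forms of degree `d` in
`k[x_0, …, x_n]`. -/
def systems (d : ℕ) : Set (Ideal (MvPolynomial (Fin (n + 1)) k)) :=
  {I | IsMinimalMonomialTogliatti d I}

variable (k n) in
/-- The set `𝒯ˢ(n,d)` of smooth minimal monomial Togliatti systems of forms of degree `d` in
`k[x_0, …, x_n]`. -/
def smoothSystems (d : ℕ) : Set (Ideal (MvPolynomial (Fin (n + 1)) k)) :=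
  {I | IsMinimalMonomialTogliatti d I ∧ IsSmoothToric k (apolarExponents d I)}

/-- The minimal number of generators of an ideal. -/
def numGens (I : Ideal (MvPolynomial (Fin (n + 1)) k)) : ℕ := Submodule.spanFinrank I

variable (k) in
/-- The ideal `I_5 = (x_0^d, x_1^d, x_2^d) + x_0^{d-1} (x_1, x_2)` and, for `5 < r ≤ d + 1`, the
ideal `I_r = (x_0^d, x_1^d, x_2^d) +
x_0^{d-r+3} x_1 x_2 (x_0^{r-5}, x_0^{r-6} x_1, …, x_0 x_1^{r-6}, x_1^{r-5}, x_2^{r-5})`. -/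
def explicitIdeal (d r : ℕ) : Ideal (MvPolynomial (Fin (2 + 1)) k) :=
  Ideal.span {X 0 ^ d, X 1 ^ d, X 2 ^ d} ⊔
    if r = 5 then Ideal.span {X 0 ^ (d - 1) * X 1, X 0 ^ (d - 1) * X 2}
    else Ideal.span {X 0 ^ (d + 3 - r) * X 1 * X 2} *
      Ideal.span ({p | ∃ i j : ℕ, i + j = r - 5 ∧ p = X 0 ^ i * X 1 ^ j} ∪ {X 2 ^ (r - 5)})

end Togliatti

end

noncomputable section

namespace Togliatti

open MvPolynomial

variable {k : Type*} [Field k] {n : ℕ}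

/-! ### Ideals generated by monomials of one degree -/

/-! The upper bound `d + 1` is part of the definition of a Togliatti system, and a set of monomials
of one degree generates its ideal minimally (`numGens_monomialIdeal`). What remains is that four
generators never suffice and that the explicit ideals are smooth minimal systems.

If `L F` lies in the ideal and `F` has degree `d - 1`, then `L F` is a combination of the generators
that vanishes on the line `L = 0` of the projective plane. So failure of injectivity is a linear
relation between the restricted generators, and it is enough to study `L = x_0 + x_1 + x_2` to show
that WLP holds (`not_failsWLP_of_linearIndependent`). Artinianity forces the three pure powers into
the generators; these together with at most one further monomial remain independent on the line, by
comparing coefficients in one variable (`monomial_independent`). Hence the bound 5.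

Conversely, since `dim R_d - dim R_{d-1} = d + 1`, a nonzero `F` killed by `L` excludes surjectivity
as well once there are at most `d + 1` generators. For `I_5` one takes `F = x_0^{d-1}`. For `r > 5`
one splits `L = u - v` with `u` in `x_2` and `v` in `x_0, x_1`, and divides `u^m - v^m` by `L`,
where `m = r - 5`. Minimality of `I_5` is the bound 5; for `r > 5` the relation on the line is
unique up to scalar and involves every generator that is not a pure power
(`eq_zero_of_strip_relation`).

For smoothness, the convex hull of the remaining exponents is a hexagon, a triangle with cut
corners. At each vertex the two neighbouring exponents generate all the others, so the affine cone
is there a torus times a plane, with tangent spaces of dimension 3 (`IsChart.rank_tangentSpace`).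
These vertex charts cover every nonzero point of the cone (`IsHexagon.exists_chart_ne_zero`). -/

theorem mem_monomialIdeal_iff {S : Finset (Fin (n + 1) →₀ ℕ)} {f : MvPolynomial (Fin (n + 1)) k} :
    f ∈ monomialIdeal k S ↔ ∀ b ∈ f.support, ∃ a ∈ S, a ≤ b := by
  simp [monomialIdeal, mem_ideal_span_monomial_image]

theorem eq_of_le_of_degree_eq {a b : Fin (n + 1) →₀ ℕ} (hab : a ≤ b) (h : a.degree = b.degree) :
    a = b := by
  obtain ⟨c, rfl⟩ := exists_add_of_le hab
  have : c.degree = 0 := by simpa using h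
  rw [Finsupp.degree_eq_zero_iff] at this
  simp [this]

theorem degree_mono {a b : Fin (n + 1) →₀ ℕ} (hab : a ≤ b) : a.degree ≤ b.degree := by
  obtain ⟨c, rfl⟩ := exists_add_of_le hab
  simp

theorem degree_of_mem_support {f : MvPolynomial (Fin (n + 1)) k} {d : ℕ} (hf : f.IsHomogeneous d)
    {b : Fin (n + 1) →₀ ℕ} (hb : b ∈ f.support) : b.degree = d := by
  by_contra h
  exact (mem_support_iff.1 hb) (hf.coeff_eq_zero h)

theorem support_subset_of_mem_monomialIdeal {S : Finset (Fin (n + 1) →₀ ℕ)} {d : ℕ}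
    (hS : ∀ a ∈ S, a.degree = d) {f : MvPolynomial (Fin (n + 1)) k} (hf : f.IsHomogeneous d)
    (hI : f ∈ monomialIdeal k S) : f.support ⊆ S := by
  intro b hb
  obtain ⟨a, ha, hab⟩ := mem_monomialIdeal_iff.1 hI b hb
  rwa [← eq_of_le_of_degree_eq hab ((hS a ha).trans (degree_of_mem_support hf hb).symm)]

theorem eq_zero_of_mem_monomialIdeal {S : Finset (Fin (n + 1) →₀ ℕ)} {d j : ℕ}
    (hS : ∀ a ∈ S, a.degree = d) (hj : j < d) {f : MvPolynomial (Fin (n + 1)) k}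
    (hf : f.IsHomogeneous j) (hI : f ∈ monomialIdeal k S) : f = 0 := by
  rw [← support_eq_empty, Finset.eq_empty_iff_forall_notMem]
  intro b hb
  obtain ⟨a, ha, hab⟩ := mem_monomialIdeal_iff.1 hI b hb
  have := degree_mono hab
  rw [hS a ha, degree_of_mem_support hf hb] at this
  omega

theorem monomial_mem_monomialIdeal {S : Finset (Fin (n + 1) →₀ ℕ)} {a : Fin (n + 1) →₀ ℕ}
    (ha : a ∈ S) : monomial a (1 : k) ∈ monomialIdeal k S :=
  Ideal.subset_span ⟨a, ha, rfl⟩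

theorem monomial_mem_monomialIdeal_iff {S : Finset (Fin (n + 1) →₀ ℕ)} {d : ℕ}
    (hS : ∀ a ∈ S, a.degree = d) {a : Fin (n + 1) →₀ ℕ} (ha : a.degree = d) :
    monomial a (1 : k) ∈ monomialIdeal k S ↔ a ∈ S := by
  refine ⟨fun h => ?_, monomial_mem_monomialIdeal⟩
  apply support_subset_of_mem_monomialIdeal hS (isHomogeneous_monomial _ ha) h
  simp

theorem linearIndependent_monomials (S : Finset (Fin (n + 1) →₀ ℕ)) :
    LinearIndependent k (fun a : S => monomial (a : Fin (n + 1) →₀ ℕ) (1 : k)) :=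
  (basisMonomials (Fin (n + 1)) k).linearIndependent.comp _ Subtype.val_injective

/-- Elements of the ideal have no terms of degree below `d`, so only the constant term of `g`
contributes in degree `d`. -/
theorem homogeneousComponent_mul_of_mem {S : Finset (Fin (n + 1) →₀ ℕ)} {d : ℕ}
    (hS : ∀ a ∈ S, a.degree = d) (g : MvPolynomial (Fin (n + 1)) k)
    {f : MvPolynomial (Fin (n + 1)) k} (hI : f ∈ monomialIdeal k S) :
    homogeneousComponent d (g * f) = coeff 0 g • homogeneousComponent d f := by
  classical
  ext b
  rw [coeff_smul, coeff_homogeneousComponent, coeff_homogeneousComponent]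
  split_ifs with hb
  · rw [coeff_mul, Finset.sum_eq_single (0, b)]
    · rfl
    · rintro ⟨p, q⟩ hpq hne
      rw [Finset.HasAntidiagonal.mem_antidiagonal] at hpq
      simp only at hpq ⊢
      by_cases hq : q ∈ f.support
      · obtain ⟨a, ha, haq⟩ := mem_monomialIdeal_iff.1 hI q hq
        have h1 := degree_mono haq
        rw [hS a ha] at h1
        have h2 : p.degree + q.degree = d := by rw [← hb, ← hpq]; simp
        have h3 : p.degree = 0 := by omega
        rw [Finsupp.degree_eq_zero_iff] at h3
        subst h3
        simp at hpq
        simp [hpq] at hne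
      · rw [notMem_support_iff.1 hq, mul_zero]
    · intro h; simp at h
  · simp

/-- The monomials of degree `d` generating a monomial ideal form a minimal set of generators. -/
theorem numGens_monomialIdeal {S : Finset (Fin (n + 1) →₀ ℕ)} {d : ℕ}
    (hS : ∀ a ∈ S, a.degree = d) : numGens (monomialIdeal k S) = S.card := by
  classical
  have hfin : ((fun a => monomial a (1 : k)) '' (S : Set (Fin (n + 1) →₀ ℕ))).Finite :=
    S.finite_toSet.image _
  apply le_antisymm
  · refine (Submodule.spanFinrank_span_le_ncard_of_finite hfin).trans ?_
    refine (Set.ncard_image_le S.finite_toSet).trans ?_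
    simp
  · have hfg : (monomialIdeal k S).FG := Submodule.fg_span hfin
    obtain ⟨G, hG, hGs⟩ := Submodule.FG.exists_span_finset_card_eq_spanFinrank hfg
    rw [numGens, ← hG]
    let W : Submodule k (MvPolynomial (Fin (n + 1)) k) :=
      Submodule.span k (homogeneousComponent d '' (G : Set (MvPolynomial (Fin (n + 1)) k)))
    -- For the lower bound: the degree `d` components of any generating set span, already over `k`,
    -- the degree `d` part of the ideal, whose dimension is at least `S.card`.
    have key : ∀ f ∈ monomialIdeal k S, homogeneousComponent d f ∈ W := by
      intro f hf
      have hGI : ∀ g ∈ G, g ∈ monomialIdeal k S := fun g hg => by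
        rw [← hGs]; exact Submodule.subset_span hg
      rw [← hGs] at hf
      induction hf using Submodule.span_induction with
      | mem x hx => exact Submodule.subset_span ⟨x, hx, rfl⟩
      | zero => simp
      | add x y _ _ hx hy => rw [map_add]; exact W.add_mem hx hy
      | smul a x hx h =>
        rw [smul_eq_mul, homogeneousComponent_mul_of_mem hS a (by rw [← hGs]; exact hx)]
        exact W.smul_mem _ h
    have hle : Submodule.span k (Set.range fun a : S =>
        monomial (a : Fin (n + 1) →₀ ℕ) (1 : k)) ≤ W := by
      rw [Submodule.span_le]
      rintro _ ⟨a, rfl⟩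
      have := key _ (monomial_mem_monomialIdeal (k := k) a.2)
      rwa [homogeneousComponent_eq_self (isHomogeneous_monomial _ (hS _ a.2))] at this
    have hWfin : ((G.image (homogeneousComponent d) :
        Finset (MvPolynomial (Fin (n + 1)) k)) : Set _) =
        homogeneousComponent d '' (G : Set (MvPolynomial (Fin (n + 1)) k)) := by simp
    have h1 : Module.finrank k W ≤ G.card := by
      have := finrank_span_finset_le_card (R := k) (G.image (homogeneousComponent d))
      rw [Set.finrank, hWfin] at this
      exact this.trans Finset.card_image_le
    have hWf : Module.Finite k W := by
      apply FiniteDimensional.span_of_finite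
      exact G.finite_toSet.image _
    have h2 := finrank_span_eq_card (linearIndependent_monomials (k := k) S)
    rw [Fintype.card_coe] at h2
    rw [← h2]
    exact (Submodule.finrank_mono hle).trans h1

/-- Every variable becomes nilpotent, hence integral, so the quotient is a finite `k`-module. -/
theorem isArtinianRing_quotient_of_single_mem {S : Finset (Fin (n + 1) →₀ ℕ)} {d : ℕ}
    (h : ∀ i, Finsupp.single i d ∈ S) :
    IsArtinianRing (MvPolynomial (Fin (n + 1)) k ⧸ monomialIdeal k S) := by
  have hint : Algebra.IsIntegral k (MvPolynomial (Fin (n + 1)) k ⧸ monomialIdeal k S) := by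
    rw [← integralClosure_eq_top_iff, eq_top_iff]
    have htop : (⊤ : Subalgebra k (MvPolynomial (Fin (n + 1)) k ⧸ monomialIdeal k S)) =
        (Algebra.adjoin k (Set.range X)).map (Ideal.Quotient.mkₐ k (monomialIdeal k S)) := by
      rw [adjoin_range_X, Algebra.map_top, eq_comm, AlgHom.range_eq_top]
      exact Ideal.Quotient.mkₐ_surjective _ _
    rw [htop, AlgHom.map_adjoin, Algebra.adjoin_le_iff]
    rintro _ ⟨_, ⟨i, rfl⟩, rfl⟩
    have hnil : IsNilpotent (Ideal.Quotient.mkₐ k (monomialIdeal k S) (X i)) := by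
      refine ⟨d, ?_⟩
      rw [← map_pow, Ideal.Quotient.mkₐ_eq_mk, Ideal.Quotient.eq_zero_iff_mem, X_pow_eq_monomial]
      exact monomial_mem_monomialIdeal (h i)
    obtain ⟨N, hN⟩ := hnil
    exact ⟨Polynomial.X ^ N, Polynomial.monic_X_pow N, by rw [Polynomial.eval₂_X_pow]; exact hN⟩
  have : Algebra.FiniteType k (MvPolynomial (Fin (n + 1)) k ⧸ monomialIdeal k S) := inferInstance
  have hf : Module.Finite k (MvPolynomial (Fin (n + 1)) k ⧸ monomialIdeal k S) :=
    Algebra.IsIntegral.finite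
  exact IsArtinianRing.of_finite k _

/-- Otherwise setting all variables but `x_i` to zero kills the ideal, and the quotient surjects
onto a polynomial ring in one variable, which is not artinian. -/
theorem single_mem_of_isArtinianRing_quotient {S : Finset (Fin (n + 1) →₀ ℕ)} {d : ℕ}
    (hS : ∀ a ∈ S, a.degree = d)
    (h : IsArtinianRing (MvPolynomial (Fin (n + 1)) k ⧸ monomialIdeal k S)) (i : Fin (n + 1)) :
    Finsupp.single i d ∈ S := by
  by_contra hi
  let φ : MvPolynomial (Fin (n + 1)) k →ₐ[k] Polynomial k :=
    aeval fun j => if j = i then Polynomial.X else 0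
  have hφ : ∀ f ∈ monomialIdeal k S, φ f = 0 := by
    intro f hf
    rw [← RingHom.mem_ker (f := φ)]
    refine (Ideal.span_le.2 ?_ : monomialIdeal k S ≤ _) hf
    rintro _ ⟨a, ha, rfl⟩
    rw [SetLike.mem_coe, RingHom.mem_ker]
    by_contra hne
    apply hi
    have hj : ∀ j, j ≠ i → a j = 0 := by
      intro j hj
      by_contra haj
      apply hne
      simp only [φ, aeval_monomial]
      rw [Finsupp.prod, Finset.prod_eq_zero (i := j) (by simpa using haj), mul_zero]
      simp [hj, haj]
    have : a = Finsupp.single i (a i) := by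
      ext j
      rw [Finsupp.single_apply]
      split_ifs with hij
      · rw [hij]
      · exact hj j (Ne.symm hij)
    have hd := hS a ha
    rw [this, Finsupp.degree_single] at hd
    rwa [this, hd] at ha
  let ψ := Ideal.Quotient.lift (monomialIdeal k S) (φ : _ →+* Polynomial k) hφ
  have hsurj : Function.Surjective ψ := by
    apply Ideal.Quotient.lift_surjective_of_surjective
    intro p
    refine ⟨Polynomial.aeval (X i) p, ?_⟩
    have : (φ.comp (Polynomial.aeval (X i))) = AlgHom.id k _ := by
      ext; simp [φ]
    exact DFunLike.congr_fun this p
  have : IsArtinianRing (Polynomial k) := hsurj.isArtinianRing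
  exact Polynomial.not_isField k (IsArtinianRing.isField_of_isDomain _)

/-! ### Failure of the weak Lefschetz property -/

theorem finrank_homogeneousSubmodule (j : ℕ) :
    Module.finrank k (homogeneousSubmodule (Fin (n + 1)) k j) = (n + j).choose j := by
  classical
  have hspan : homogeneousSubmodule (Fin (n + 1)) k j = Submodule.span k (Set.range
      fun a : (Finset.univ : Finset (Fin (n + 1))).finsuppAntidiag j =>
        monomial (a : Fin (n + 1) →₀ ℕ) (1 : k)) := by
    apply le_antisymm
    · intro f hf
      rw [as_sum f]
      refine Submodule.sum_mem _ fun a ha => ?_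
      rw [show monomial a (coeff a f) = coeff a f • monomial a (1 : k) by simp [smul_monomial]]
      refine Submodule.smul_mem _ _ (Submodule.subset_span ⟨⟨a, ?_⟩, rfl⟩)
      have := degree_of_mem_support ((mem_homogeneousSubmodule _ _).1 hf) ha
      simpa [Finsupp.degree_eq_sum] using this
    · rw [Submodule.span_le]
      rintro _ ⟨⟨a, ha⟩, rfl⟩
      apply isHomogeneous_monomial
      simpa [Finsupp.degree_eq_sum] using ha
  rw [hspan, finrank_span_eq_card (linearIndependent_monomials _), Fintype.card_coe,
    Finset.card_finsuppAntidiag_nat_eq_choose]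
  simp only [Finset.card_univ, Fintype.card_fin]
  congr 1
  omega

instance finite_homogeneousSubmodule (j : ℕ) :
    Module.Finite k (homogeneousSubmodule (Fin (n + 1)) k j) :=
  Module.Finite.iff_fg.2 (homogeneousSubmodule_fg (Fin (n + 1)) k j)

instance finite_gradedPiece (I : Ideal (MvPolynomial (Fin (n + 1)) k)) (j : ℕ) :
    Module.Finite k (gradedPiece I j) :=
  inferInstanceAs (Module.Finite k ((homogeneousSubmodule (Fin (n + 1)) k j).map _))

theorem le_finrank_gradedPiece_add_card {S : Finset (Fin (n + 1) →₀ ℕ)} {d : ℕ}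
    (hS : ∀ a ∈ S, a.degree = d) :
    (n + d).choose d ≤ Module.finrank k (gradedPiece (monomialIdeal k S) d) + S.card := by
  classical
  let π := (Ideal.Quotient.mkₐ k (monomialIdeal k S)).toLinearMap
  let ρ := π.domRestrict (homogeneousSubmodule (Fin (n + 1)) k d)
  have h := ρ.finrank_range_add_finrank_ker
  rw [finrank_homogeneousSubmodule] at h
  have hr : LinearMap.range ρ = gradedPiece (monomialIdeal k S) d := by
    simp only [ρ, gradedPiece, LinearMap.range_domRestrict, π]
  rw [hr] at h
  rw [← h]
  gcongr
  have hle : (LinearMap.ker ρ).map (homogeneousSubmodule (Fin (n + 1)) k d).subtype ≤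
      Submodule.span k
        ((S.image fun a => monomial a (1 : k) :
          Finset (MvPolynomial (Fin (n + 1)) k)) : Set _) := by
    rintro _ ⟨f, hf, rfl⟩
    have hfI : (f : MvPolynomial (Fin (n + 1)) k) ∈ monomialIdeal k S := by
      rw [← Ideal.Quotient.eq_zero_iff_mem]
      exact hf
    have hsupp := support_subset_of_mem_monomialIdeal hS ((mem_homogeneousSubmodule _ _).1 f.2) hfI
    rw [Submodule.subtype_apply, as_sum (f : MvPolynomial (Fin (n + 1)) k)]
    refine Submodule.sum_mem _ fun a ha => ?_
    rw [show monomial a (coeff a (f : MvPolynomial (Fin (n + 1)) k)) =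
      coeff a (f : MvPolynomial (Fin (n + 1)) k) • monomial a (1 : k) by simp [smul_monomial]]
    exact Submodule.smul_mem _ _ (Submodule.subset_span
      (Finset.mem_coe.2 (Finset.mem_image_of_mem _ (hsupp ha))))
  have heq := LinearEquiv.finrank_eq (Submodule.equivMapOfInjective _
    (Submodule.injective_subtype (homogeneousSubmodule (Fin (n + 1)) k d)) (LinearMap.ker ρ))
  exact heq.le.trans <| (Submodule.finrank_mono hle).trans
    ((finrank_span_finset_le_card _).trans Finset.card_image_le)

/-- The class of `F` is nonzero because the ideal starts in degree `d`, so `×L` is not injective. As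
the source is then no larger than the target, a nonzero kernel leaves an image that is too small. -/
theorem failsWLP_of_exists_mul_mem {S : Finset (Fin (2 + 1) →₀ ℕ)} {d : ℕ} (hd : 0 < d)
    (hS : ∀ a ∈ S, a.degree = d) (hcard : S.card ≤ d + 1)
    (h : ∀ L : MvPolynomial (Fin (2 + 1)) k, L.IsHomogeneous 1 →
      ∃ F : MvPolynomial (Fin (2 + 1)) k, F.IsHomogeneous (d - 1) ∧ F ≠ 0 ∧
        L * F ∈ monomialIdeal k S) :
    FailsWLP (monomialIdeal k S) (d - 1) := by
  intro L hL hmax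
  obtain ⟨F, hF, hF0, hLF⟩ := h L hL
  set I := monomialIdeal k S with hI
  have hmem : Ideal.Quotient.mk I F ∈ gradedPiece I (d - 1) := ⟨F, hF, rfl⟩
  have hne : Ideal.Quotient.mk I F ≠ 0 := by
    rw [Ne, Ideal.Quotient.eq_zero_iff_mem]
    exact fun hFI => hF0 (eq_zero_of_mem_monomialIdeal hS (by omega) hF hFI)
  have hzero : Ideal.Quotient.mk I L * Ideal.Quotient.mk I F = 0 := by
    rw [← map_mul, Ideal.Quotient.eq_zero_iff_mem]
    exact hLF
  rcases hmax with hinj | hsurj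
  · exact hne (hinj hmem (gradedPiece I (d - 1)).zero_mem (by simp [hzero]))
  · let μ := (LinearMap.mulLeft k (Ideal.Quotient.mk I L)).domRestrict (gradedPiece I (d - 1))
    have hle : gradedPiece I d ≤ LinearMap.range μ := by
      intro u hu
      rw [← Nat.sub_add_cancel hd] at hu
      obtain ⟨v, hv, rfl⟩ := hsurj hu
      exact ⟨⟨v, hv⟩, rfl⟩
    have h1 := Submodule.finrank_mono hle
    have h2 := μ.finrank_range_add_finrank_ker
    have h3 : 0 < Module.finrank k (LinearMap.ker μ) := by
      have hx : (⟨⟨_, hmem⟩, hzero⟩ : LinearMap.ker μ) ≠ 0 := fun h =>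
        hne (congrArg Subtype.val (congrArg Subtype.val h))
      have : Nontrivial (LinearMap.ker μ) := ⟨_, _, hx⟩
      exact Module.finrank_pos (R := k) (M := LinearMap.ker μ)
    have h4 := le_finrank_gradedPiece_add_card (k := k) hS
    rw [← hI] at h4
    have h5 : Module.finrank k (gradedPiece I (d - 1)) ≤ (2 + (d - 1)).choose (d - 1) := by
      rw [← finrank_homogeneousSubmodule (k := k)]
      exact Submodule.finrank_map_le _ _
    clear_value I μ
    obtain ⟨j, rfl⟩ : ∃ j, d = j + 1 := ⟨d - 1, by omega⟩
    -- `dim R_d - dim R_{d-1} = d + 1`: this is where the bound on the number of generators enters.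
    have h6 : (2 + (j + 1)).choose (j + 1) = (2 + j).choose j + (j + 2) := by
      rw [show 2 + (j + 1) = (2 + j) + 1 by ring, Nat.choose_succ_succ,
        show 2 + j = j + 1 + 1 by ring, Nat.choose_succ_self_right]
    simp only [Nat.add_sub_cancel] at h2 h5
    omega

theorem isTogliatti_monomialIdeal {S : Finset (Fin (2 + 1) →₀ ℕ)} {d : ℕ} (hd : 0 < d)
    (hS : ∀ a ∈ S, a.degree = d) (hcard : S.card ≤ d + 1)
    (hpure : ∀ i, Finsupp.single i d ∈ S)
    (h : ∀ L : MvPolynomial (Fin (2 + 1)) k, L.IsHomogeneous 1 →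
      ∃ F : MvPolynomial (Fin (2 + 1)) k, F.IsHomogeneous (d - 1) ∧ F ≠ 0 ∧
        L * F ∈ monomialIdeal k S) :
    IsTogliatti d (monomialIdeal k S) := by
  refine ⟨⟨S.card, fun i => monomial (S.equivFin.symm i : Fin (2 + 1) →₀ ℕ) (1 : k), ?_, ?_, ?_⟩,
    isArtinianRing_quotient_of_single_mem hpure, failsWLP_of_exists_mul_mem hd hS hcard h⟩
  · simpa [add_comm, Nat.add_sub_cancel] using hcard
  · intro i
    exact isHomogeneous_monomial _ (hS _ (S.equivFin.symm i).2)
  · rw [monomialIdeal]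
    congr 1
    ext f
    constructor
    · rintro ⟨a, ha, rfl⟩
      exact ⟨S.equivFin ⟨a, ha⟩, by simp⟩
    · rintro ⟨i, rfl⟩
      exact ⟨_, (S.equivFin.symm i).2, rfl⟩

/-- If the monomials in `S` are linearly independent as functions on the plane
`x_0 + ⋯ + x_n = 0`, then multiplication by `x_0 + ⋯ + x_n` is injective in degree `d - 1`. -/
theorem not_failsWLP_of_linearIndependent {S : Finset (Fin (n + 1) →₀ ℕ)} {d : ℕ} (hd : 0 < d)
    (hS : ∀ a ∈ S, a.degree = d)
    (h : ∀ c : (Fin (n + 1) →₀ ℕ) → k,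
      (∀ x : Fin (n + 1) → k, ∑ i, x i = 0 → ∑ a ∈ S, c a * ∏ i, x i ^ a i = 0) →
        ∀ a ∈ S, c a = 0) :
    ¬ FailsWLP (monomialIdeal k S) (d - 1) := by
  intro hW
  have hL : (∑ i, X i : MvPolynomial (Fin (n + 1)) k).IsHomogeneous 1 :=
    IsHomogeneous.sum _ _ _ fun i _ => isHomogeneous_X k i
  have hL0 : (∑ i, X i : MvPolynomial (Fin (n + 1)) k) ≠ 0 := by
    intro h0
    have := congrArg (eval (Pi.single (0 : Fin (n + 1)) (1 : k))) h0
    simp at this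
  refine hW _ hL (Or.inl ?_)
  rintro _ ⟨F, hF, rfl⟩ _ ⟨G, hG, rfl⟩ hFG
  have hmem : (∑ i, X i) * (F - G) ∈ monomialIdeal k S := by
    rw [mul_sub, ← Ideal.Quotient.eq, map_mul, map_mul]
    exact hFG
  have hhom : ((∑ i, X i) * (F - G)).IsHomogeneous d := by
    have := hL.mul (((mem_homogeneousSubmodule _ _).1 hF).sub ((mem_homogeneousSubmodule _ _).1 hG))
    rwa [show 1 + (d - 1) = d by omega] at this
  have hsupp := support_subset_of_mem_monomialIdeal hS hhom hmem
  -- The product is a combination of the monomials in `S`, and it vanishes on the plane because its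
  -- first factor does.
  have hzero : (∑ i, X i) * (F - G) = 0 := by
    rw [← support_eq_empty, Finset.eq_empty_iff_forall_notMem]
    intro b hb
    refine mem_support_iff.1 hb (h (fun a => coeff a _) ?_ b (hsupp hb))
    intro x hx
    have hev : eval x ((∑ i, X i) * (F - G)) = 0 := by simp [hx]
    rw [eval_eq'] at hev
    rw [← hev]
    symm
    apply Finset.sum_subset hsupp
    intro a _ ha
    rw [notMem_support_iff.1 ha, zero_mul]
  rcases mul_eq_zero.1 hzero with h0 | h0
  · exact absurd h0 hL0
  · rw [sub_eq_zero.1 h0]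

/-! ### Exponents in three variables -/

/-- The exponent of the monomial `x_0^a x_1^b x_2^c`. -/
def expo (a b c : ℕ) : Fin (2 + 1) →₀ ℕ := Finsupp.equivFunOnFinite.symm ![a, b, c]

@[simp] theorem expo_zero (a b c : ℕ) : expo a b c 0 = a := rfl
@[simp] theorem expo_one (a b c : ℕ) : expo a b c 1 = b := rfl
@[simp] theorem expo_two (a b c : ℕ) : expo a b c 2 = c := rfl

theorem expo_ext {a b : Fin (2 + 1) →₀ ℕ} (h0 : a 0 = b 0) (h1 : a 1 = b 1) (h2 : a 2 = b 2) :
    a = b := by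
  ext i
  fin_cases i
  exacts [h0, h1, h2]

theorem expo_inj {a b c a' b' c' : ℕ} : expo a b c = expo a' b' c' ↔ a = a' ∧ b = b' ∧ c = c' := by
  constructor
  · intro h
    exact ⟨DFunLike.congr_fun h 0, DFunLike.congr_fun h 1, DFunLike.congr_fun h 2⟩
  · rintro ⟨rfl, rfl, rfl⟩
    rfl

theorem eq_expo (a : Fin (2 + 1) →₀ ℕ) : a = expo (a 0) (a 1) (a 2) := expo_ext rfl rfl rfl

theorem degree_eq_add (a : Fin (2 + 1) →₀ ℕ) : a.degree = a 0 + a 1 + a 2 := by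
  rw [Finsupp.degree_eq_sum]
  exact Fin.sum_univ_three a

@[simp] theorem degree_expo (a b c : ℕ) : (expo a b c).degree = a + b + c := degree_eq_add _

theorem prod_pow_eq (x : Fin (2 + 1) → k) (a : Fin (2 + 1) →₀ ℕ) :
    ∏ i, x i ^ a i = x 0 ^ a 0 * x 1 ^ a 1 * x 2 ^ a 2 :=
  Fin.prod_univ_three fun i => x i ^ a i

theorem sum_univ_eq (x : Fin (2 + 1) → k) : ∑ i, x i = x 0 + x 1 + x 2 := Fin.sum_univ_three x

theorem monomial_expo (a b c : ℕ) :
    monomial (expo a b c) (1 : k) = X 0 ^ a * X 1 ^ b * X 2 ^ c := by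
  rw [monomial_eq, Finsupp.prod_fintype _ _ (by simp), C_1, one_mul]
  exact Fin.prod_univ_three fun i => (X i : MvPolynomial (Fin (2 + 1)) k) ^ expo a b c i

theorem single_zero_eq (d : ℕ) : (Finsupp.single 0 d : Fin (2 + 1) →₀ ℕ) = expo d 0 0 :=
  expo_ext (by simp) (by simp) (by simp)

theorem single_one_eq (d : ℕ) : (Finsupp.single 1 d : Fin (2 + 1) →₀ ℕ) = expo 0 d 0 :=
  expo_ext (by simp) (by simp) (by simp)

theorem single_two_eq (d : ℕ) : (Finsupp.single 2 d : Fin (2 + 1) →₀ ℕ) = expo 0 0 d :=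
  expo_ext (by simp) (by simp) (by simp)

theorem forall_single_mem {S : Finset (Fin (2 + 1) →₀ ℕ)} {d : ℕ} :
    (∀ i, Finsupp.single i d ∈ S) ↔ expo d 0 0 ∈ S ∧ expo 0 d 0 ∈ S ∧ expo 0 0 d ∈ S := by
  rw [← single_zero_eq, ← single_one_eq, ← single_two_eq]
  exact Fin.forall_fin_succ.trans (and_congr Iff.rfl (Fin.forall_fin_two))

/-! ### Forms on the plane `x + y + z = 0` -/

theorem polynomial_eq_of_forall_eval [Infinite k] {p q : Polynomial k}
    (h : ∀ t, p.eval t = q.eval t) : p = q :=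
  Polynomial.funext h

theorem neg_one_add_pow (t : k) (d : ℕ) : (-(1 + t)) ^ d = (-1) ^ d * (1 + t) ^ d := by
  rw [← mul_pow, neg_one_mul]

/-- On the points `(1, t, -1 - t)` only `z^d` contributes to the coefficient of `t`, namely `± d
c₂`; characteristic zero gives `c₂ = 0`. -/
theorem pure_powers_independent [CharZero k] {d : ℕ} (hd : 2 ≤ d) {c₀ c₁ c₂ : k}
    (h : ∀ x y z : k, x + y + z = 0 → c₀ * x ^ d + c₁ * y ^ d + c₂ * z ^ d = 0) :
    c₀ = 0 ∧ c₁ = 0 ∧ c₂ = 0 := by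
  have hp : Polynomial.C c₀ + Polynomial.C c₁ * Polynomial.X ^ d +
      Polynomial.C (c₂ * (-1) ^ d) * (1 + Polynomial.X) ^ d = 0 := by
    refine polynomial_eq_of_forall_eval fun t => ?_
    have := h 1 t (-(1 + t)) (by ring)
    rw [neg_one_add_pow] at this
    simp only [Polynomial.eval_add, Polynomial.eval_C, Polynomial.eval_mul, Polynomial.eval_pow,
      Polynomial.eval_X, Polynomial.eval_one, Polynomial.eval_zero]
    rw [← this]
    ring
  have h1 := congrArg (Polynomial.coeff · 1) hp
  simp only [Polynomial.coeff_add, Polynomial.coeff_C_mul, Polynomial.coeff_X_pow,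
    Polynomial.coeff_one_add_X_pow, Polynomial.coeff_zero, Polynomial.coeff_C] at h1
  have hd' : (d : k) ≠ 0 := by exact_mod_cast (by omega : d ≠ 0)
  have hc : c₂ = 0 := by
    simpa [show ¬ (1 = d) by omega, hd'] using h1
  subst hc
  have h2 := h 1 0 (-1) (by ring)
  have h3 := h 0 1 (-1) (by ring)
  have hd0 : d ≠ 0 := by omega
  simp [hd0] at h2 h3
  exact ⟨h2, h3, rfl⟩

/-- With `x = 1`, `y = t`, the right side is `t^b`, while the left side has every middle coefficient
equal to `± c₂` times a nonzero binomial. A middle index other than `b` gives `c₂ = 0`,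
contradicting the coefficient at `b`. -/
theorem edge_monomial_independent [CharZero k] {d a b : ℕ} (hd : 4 ≤ d) (hab : a + b = d)
    (ha : a < d) (hb : b < d) {c₀ c₁ c₂ : k}
    (h : ∀ x y z : k, x + y + z = 0 → c₀ * x ^ d + c₁ * y ^ d + c₂ * z ^ d = x ^ a * y ^ b) :
    False := by
  have hp : Polynomial.C c₀ + Polynomial.C c₁ * Polynomial.X ^ d +
      Polynomial.C (c₂ * (-1) ^ d) * (1 + Polynomial.X) ^ d = Polynomial.X ^ b := by
    refine polynomial_eq_of_forall_eval fun t => ?_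
    have := h 1 t (-(1 + t)) (by ring)
    rw [neg_one_add_pow, one_pow, one_pow, one_mul] at this
    simp only [Polynomial.eval_add, Polynomial.eval_C, Polynomial.eval_mul, Polynomial.eval_pow,
      Polynomial.eval_X, Polynomial.eval_one]
    rw [← this]
    ring
  have hcoeff : ∀ j, 0 < j → j < d → c₂ * (-1) ^ d * (d.choose j : k) = if j = b then 1 else 0 := by
    intro j hj0 hj
    have h1 := congrArg (Polynomial.coeff · j) hp
    simpa only [Polynomial.coeff_add, Polynomial.coeff_C_mul, Polynomial.coeff_X_pow,
      Polynomial.coeff_one_add_X_pow, Polynomial.coeff_C, if_neg hj.ne, if_neg hj0.ne', mul_zero,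
      zero_add] using h1
  have hc : c₂ * (-1) ^ d = 0 := by
    obtain ⟨j, hj0, hj, hjb⟩ : ∃ j, 0 < j ∧ j < d ∧ j ≠ b := by
      by_cases hb1 : b = 1
      · exact ⟨2, by omega, by omega, by omega⟩
      · exact ⟨1, by omega, by omega, by omega⟩
    have := hcoeff j hj0 hj
    rw [if_neg hjb] at this
    exact (mul_eq_zero.1 this).resolve_right (by exact_mod_cast (Nat.choose_pos hj.le).ne')
  have := hcoeff b (by omega) hb
  simp [hc] at this

/-- With `x = 1`, `y = t`, the right side is divisible by `t^2`, so the coefficient of `t` gives `c₂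
= 0`. Points with `y = 0` or `z = 0` then remove `c₀` and `c₁`. -/
theorem interior_monomial_independent [CharZero k] {d a b c : ℕ} (hd : 4 ≤ d)
    (hb : 2 ≤ b) (hc : 1 ≤ c) {c₀ c₁ c₂ : k}
    (h : ∀ x y z : k, x + y + z = 0 →
      c₀ * x ^ d + c₁ * y ^ d + c₂ * z ^ d = x ^ a * y ^ b * z ^ c) :
    False := by
  have hp : Polynomial.C c₀ + Polynomial.C c₁ * Polynomial.X ^ d +
      Polynomial.C (c₂ * (-1) ^ d) * (1 + Polynomial.X) ^ d =
        Polynomial.X ^ b * (-(1 + Polynomial.X)) ^ c := by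
    refine polynomial_eq_of_forall_eval fun t => ?_
    have := h 1 t (-(1 + t)) (by ring)
    rw [neg_one_add_pow, one_pow, one_pow, one_mul] at this
    simp only [Polynomial.eval_add, Polynomial.eval_C, Polynomial.eval_mul, Polynomial.eval_pow,
      Polynomial.eval_X, Polynomial.eval_one, Polynomial.eval_neg]
    rw [← this]
    ring
  have h1 := congrArg (Polynomial.coeff · 1) hp
  simp only [Polynomial.coeff_add, Polynomial.coeff_C_mul, Polynomial.coeff_X_pow,
    Polynomial.coeff_one_add_X_pow, Polynomial.coeff_C, Polynomial.coeff_X_pow_mul'] at h1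
  have hd' : (d : k) ≠ 0 := by exact_mod_cast (by omega : d ≠ 0)
  have hc2 : c₂ = 0 := by
    simpa [show ¬ (1 = d) by omega, show ¬ (b ≤ 1) by omega, hd'] using h1
  subst hc2
  have hd0 : d ≠ 0 := by omega
  have hb0 : b ≠ 0 := by omega
  have hc0 : c ≠ 0 := by omega
  have h2 := h 1 0 (-1) (by ring)
  have h3 := h (-1) 1 0 (by ring)
  simp [hd0, hb0, hc0] at h2 h3
  subst h2
  simp at h3
  subst h3
  have h4 := h 1 1 (-2) (by ring)
  simp at h4
  exact pow_ne_zero c (by norm_num) h4.symm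

/-- Up to permuting the variables, either one exponent is zero, or all are positive and one is at
least 2 because `d ≥ 4`. -/
theorem monomial_independent [CharZero k] {d a b c : ℕ} (hd : 4 ≤ d) (habc : a + b + c = d)
    (ha : a < d) (hb : b < d) (hc : c < d) {c₀ c₁ c₂ : k}
    (h : ∀ x y z : k, x + y + z = 0 →
      c₀ * x ^ d + c₁ * y ^ d + c₂ * z ^ d = x ^ a * y ^ b * z ^ c) :
    False := by
  rcases Nat.eq_zero_or_pos c with rfl | hc1
  · exact edge_monomial_independent (c₀ := c₀) (c₁ := c₁) (c₂ := c₂) hd (by omega) ha hb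
      fun x y z hs => by simpa using h x y z hs
  rcases Nat.eq_zero_or_pos b with rfl | hb1
  · refine edge_monomial_independent (c₀ := c₀) (c₁ := c₂) (c₂ := c₁) hd (by omega) ha hc
      fun x y z hs => ?_
    have := h x z y (by rw [← hs]; ring)
    rw [pow_zero, mul_one] at this
    rw [← this]; ring
  rcases Nat.eq_zero_or_pos a with rfl | ha1
  · refine edge_monomial_independent (c₀ := c₂) (c₁ := c₁) (c₂ := c₀) hd (by omega) hc hb
      fun x y z hs => ?_
    have := h z y x (by rw [← hs]; ring)
    rw [pow_zero, one_mul] at this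
    rw [mul_comm (x ^ c), ← this]; ring
  by_cases hb2 : 2 ≤ b
  · exact interior_monomial_independent hd hb2 hc1 h
  by_cases ha2 : 2 ≤ a
  · refine interior_monomial_independent (a := b) (c₀ := c₁) (c₁ := c₀) (c₂ := c₂) hd ha2 hc1
      fun x y z hs => ?_
    have := h y x z (by rw [← hs]; ring)
    rw [mul_comm (x ^ b), ← this]; ring
  · refine interior_monomial_independent (a := a) (c₀ := c₀) (c₁ := c₂) (c₂ := c₁) hd
      (by omega : 2 ≤ c) hb1 fun x y z hs => ?_
    have := h x z y (by rw [← hs]; ring)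
    rw [mul_right_comm, ← this]; ring

/-! ### Togliatti systems have at least five generators -/

/-- The exponents of the pure powers `x_0^d`, `x_1^d`, `x_2^d`. -/
def pureExponents (d : ℕ) : Finset (Fin (2 + 1) →₀ ℕ) := {expo d 0 0, expo 0 d 0, expo 0 0 d}

theorem sum_pureExponents {M : Type*} [AddCommMonoid M] {d : ℕ} (hd : 0 < d)
    (f : (Fin (2 + 1) →₀ ℕ) → M) :
    ∑ a ∈ pureExponents d, f a = f (expo d 0 0) + (f (expo 0 d 0) + f (expo 0 0 d)) := by
  rw [pureExponents, Finset.sum_insert, Finset.sum_insert, Finset.sum_singleton]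
  all_goals
    simp only [Finset.mem_insert, Finset.mem_singleton, expo_inj]
    omega

theorem card_pureExponents {d : ℕ} (hd : 0 < d) : (pureExponents d).card = 3 := by
  rw [Finset.card_eq_sum_ones, sum_pureExponents hd]
  rfl

theorem pureExponents_subset {S : Finset (Fin (2 + 1) →₀ ℕ)} {d : ℕ}
    (hS : ∀ a ∈ S, a.degree = d) (h : IsTogliatti d (monomialIdeal k S)) :
    pureExponents d ⊆ S := by
  obtain ⟨h0, h1, h2⟩ := forall_single_mem.1 (single_mem_of_isArtinianRing_quotient hS h.2.1)
  simp [pureExponents, Finset.insert_subset_iff, h0, h1, h2]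

theorem five_le_card_of_isTogliatti [CharZero k] {d : ℕ} (hd : 4 ≤ d)
    {S : Finset (Fin (2 + 1) →₀ ℕ)} (hS : ∀ a ∈ S, a.degree = d)
    (h : IsTogliatti d (monomialIdeal k S)) : 5 ≤ S.card := by
  classical
  by_contra hlt
  have hsub := pureExponents_subset hS h
  have hcard3 := card_pureExponents (show 0 < d by omega)
  have hcard : (S \ pureExponents d).card ≤ 1 := by
    rw [Finset.card_sdiff_of_subset hsub]
    omega
  refine not_failsWLP_of_linearIndependent (by omega) hS (fun c hc => ?_) h.2.2
  have hc' : ∀ x y z : k, x + y + z = 0 →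
      ∑ a ∈ S \ pureExponents d, c a * (x ^ a 0 * y ^ a 1 * z ^ a 2) +
        (c (expo d 0 0) * x ^ d + c (expo 0 d 0) * y ^ d + c (expo 0 0 d) * z ^ d) = 0 := by
    intro x y z hs
    have := hc ![x, y, z] ((sum_univ_eq _).trans hs)
    rw [← Finset.sum_sdiff hsub, sum_pureExponents (by omega)] at this
    simp only [prod_pow_eq] at this
    rw [← this]
    simp
    ring
  have hrest : ∀ a ∈ S \ pureExponents d, c a = 0 := by
    intro a ha
    have haS := Finset.mem_sdiff.1 ha
    have hs : S \ pureExponents d = {a} :=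
      Finset.eq_singleton_iff_unique_mem.2
        ⟨ha, fun b hb => Finset.card_le_one.1 hcard b hb a ha⟩
    by_contra hca
    have hdeg := hS a haS.1
    rw [degree_eq_add] at hdeg
    have hpure : a ∉ pureExponents d := haS.2
    rw [eq_expo a] at hpure
    simp only [pureExponents, Finset.mem_insert, Finset.mem_singleton, expo_inj] at hpure
    refine monomial_independent (k := k) (d := d) (a := a 0) (b := a 1) (c := a 2)
      (c₀ := -c (expo d 0 0) / c a) (c₁ := -c (expo 0 d 0) / c a) (c₂ := -c (expo 0 0 d) / c a)
      hd hdeg (by omega) (by omega) (by omega) fun x y z hxyz => ?_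
    have := hc' x y z hxyz
    rw [hs, Finset.sum_singleton] at this
    field_simp
    linear_combination -this
  have hpure := pure_powers_independent (k := k) (d := d) (by omega) fun x y z hxyz => by
    have := hc' x y z hxyz
    rwa [Finset.sum_eq_zero fun a ha => by rw [hrest a ha, zero_mul], zero_add] at this
  intro a ha
  by_cases hap : a ∈ pureExponents d
  · simp only [pureExponents, Finset.mem_insert, Finset.mem_singleton] at hap
    rcases hap with rfl | rfl | rfl
    exacts [hpure.1, hpure.2.1, hpure.2.2]
  · exact hrest a (Finset.mem_sdiff.2 ⟨ha, hap⟩)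

/-! ### The explicit systems -/

/-- The exponents of the generators of `(x_0^d, x_1^d, x_2^d) + x_0^{d-1} (x_1, x_2)`. -/
def cornerExponents (d : ℕ) : Finset (Fin (2 + 1) →₀ ℕ) :=
  insert (expo (d - 1) 1 0) (insert (expo (d - 1) 0 1) (pureExponents d))

/-- The exponents of the monomials `x_0^e x_1 x_2 g`, for `g` equal to `x_2^m` or to a monomial of
degree `m` in `x_0, x_1`. -/
def innerExponents (e m : ℕ) : Finset (Fin (2 + 1) →₀ ℕ) :=
  insert (expo e 1 (1 + m)) ((Finset.range (m + 1)).image fun i => expo (e + (m - i)) (1 + i) 1)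

/-- The exponents of the generators of
`(x_0^d, x_1^d, x_2^d) + x_0^e x_1 x_2 (x_0^m, x_0^{m-1} x_1, …, x_1^m, x_2^m)`, for
`d = e + m + 2`. -/
def stripExponents (e m : ℕ) : Finset (Fin (2 + 1) →₀ ℕ) :=
  innerExponents e m ∪ pureExponents (e + m + 2)

theorem degree_of_mem_pureExponents {d : ℕ} {a : Fin (2 + 1) →₀ ℕ} (ha : a ∈ pureExponents d) :
    a.degree = d := by
  simp only [pureExponents, Finset.mem_insert, Finset.mem_singleton] at ha
  rcases ha with rfl | rfl | rfl <;> simp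

theorem degree_of_mem_cornerExponents {d : ℕ} (hd : 0 < d) {a : Fin (2 + 1) →₀ ℕ}
    (ha : a ∈ cornerExponents d) : a.degree = d := by
  simp only [cornerExponents, Finset.mem_insert] at ha
  rcases ha with rfl | rfl | h
  · simp; omega
  · simp; omega
  · exact degree_of_mem_pureExponents h

theorem card_cornerExponents {d : ℕ} (hd : 2 ≤ d) : (cornerExponents d).card = 5 := by
  rw [cornerExponents, Finset.card_insert_of_notMem, Finset.card_insert_of_notMem,
    card_pureExponents (by omega)]
  all_goals
    simp only [pureExponents, Finset.mem_insert, Finset.mem_singleton, expo_inj]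
    omega

theorem mem_innerExponents {e m : ℕ} {a : Fin (2 + 1) →₀ ℕ} :
    a ∈ innerExponents e m ↔
      a = expo e 1 (1 + m) ∨ ∃ i ≤ m, expo (e + (m - i)) (1 + i) 1 = a := by
  simp [innerExponents]

theorem disjoint_inner_pure (e m : ℕ) (d : ℕ) :
    Disjoint (innerExponents e m) (pureExponents d) := by
  rw [Finset.disjoint_left]
  intro a ha hp
  rw [mem_innerExponents] at ha
  simp only [pureExponents, Finset.mem_insert, Finset.mem_singleton] at hp
  rcases ha with rfl | ⟨i, -, rfl⟩ <;> simp only [expo_inj] at hp <;> omega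

theorem sum_innerExponents {M : Type*} [AddCommMonoid M] {e m : ℕ} (hm : 0 < m)
    (f : (Fin (2 + 1) →₀ ℕ) → M) :
    ∑ a ∈ innerExponents e m, f a = f (expo e 1 (1 + m)) +
      ∑ i ∈ Finset.range (m + 1), f (expo (e + (m - i)) (1 + i) 1) := by
  rw [innerExponents, Finset.sum_insert, Finset.sum_image]
  · intro i _ j _ hij
    simp only [expo_inj] at hij
    omega
  · simp only [Finset.mem_image, expo_inj, not_exists, not_and]
    intros
    omega

theorem degree_of_mem_stripExponents {e m : ℕ} {a : Fin (2 + 1) →₀ ℕ}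
    (ha : a ∈ stripExponents e m) : a.degree = e + m + 2 := by
  rw [stripExponents, Finset.mem_union, mem_innerExponents] at ha
  rcases ha with (rfl | ⟨i, hi, rfl⟩) | h
  · simp; omega
  · simp; omega
  · exact degree_of_mem_pureExponents h

theorem card_stripExponents {e m : ℕ} (hm : 0 < m) : (stripExponents e m).card = m + 5 := by
  rw [stripExponents, Finset.card_union_of_disjoint (disjoint_inner_pure _ _ _),
    card_pureExponents (by omega), Finset.card_eq_sum_ones, sum_innerExponents hm]
  simp
  omega

theorem linear_form_eq {L : MvPolynomial (Fin (2 + 1)) k} (hL : L.IsHomogeneous 1) :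
    ∃ a b c : k, L = C a * X 0 + C b * X 1 + C c * X 2 := by
  have h : L ∈ homogeneousSubmodule (Fin (2 + 1)) k 1 := hL
  rw [homogeneousSubmodule_one_eq_span_X, Submodule.mem_span_range_iff_exists_fun] at h
  obtain ⟨c, hc⟩ := h
  refine ⟨c 0, c 1, c 2, ?_⟩
  rw [← hc]
  simp only [smul_eq_C_mul]
  exact Fin.sum_univ_three fun i => C (c i) * (X i : MvPolynomial (Fin (2 + 1)) k)

theorem isTogliatti_cornerExponents {d : ℕ} (hd : 4 ≤ d) :
    IsTogliatti d (monomialIdeal k (cornerExponents d)) := by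
  refine isTogliatti_monomialIdeal (by omega)
    (fun a ha => degree_of_mem_cornerExponents (by omega) ha)
    (by rw [card_cornerExponents (by omega)]; omega)
    (forall_single_mem.2 (by simp [cornerExponents, pureExponents])) fun L hL => ?_
  refine ⟨X 0 ^ (d - 1), isHomogeneous_X_pow _ _, pow_ne_zero _ (X_ne_zero _), ?_⟩
  obtain ⟨a, b, c, rfl⟩ := linear_form_eq hL
  have h0 : (X 0 : MvPolynomial (Fin (2 + 1)) k) ^ d ∈ monomialIdeal k (cornerExponents d) := by
    have := monomial_mem_monomialIdeal (k := k)
      (show expo d 0 0 ∈ cornerExponents d by simp [cornerExponents, pureExponents])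
    simpa [monomial_expo] using this
  have h1 : (X 0 : MvPolynomial (Fin (2 + 1)) k) ^ (d - 1) * X 1 ∈
      monomialIdeal k (cornerExponents d) := by
    have := monomial_mem_monomialIdeal (k := k)
      (show expo (d - 1) 1 0 ∈ cornerExponents d by simp [cornerExponents])
    simpa [monomial_expo] using this
  have h2 : (X 0 : MvPolynomial (Fin (2 + 1)) k) ^ (d - 1) * X 2 ∈
      monomialIdeal k (cornerExponents d) := by
    have := monomial_mem_monomialIdeal (k := k)
      (show expo (d - 1) 0 1 ∈ cornerExponents d by simp [cornerExponents])
    simpa [monomial_expo] using this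
  have hd1 : (X 0 : MvPolynomial (Fin (2 + 1)) k) ^ d = X 0 ^ (d - 1) * X 0 := by
    rw [← pow_succ, Nat.sub_add_cancel (by omega)]
  rw [show (C a * X 0 + C b * X 1 + C c * X 2 : MvPolynomial (Fin (2 + 1)) k) * X 0 ^ (d - 1) =
    C a * X 0 ^ d + C b * (X 0 ^ (d - 1) * X 1) + C c * (X 0 ^ (d - 1) * X 2) by rw [hd1]; ring]
  exact Ideal.add_mem _ (Ideal.add_mem _ (Ideal.mul_mem_left _ _ h0) (Ideal.mul_mem_left _ _ h1))
    (Ideal.mul_mem_left _ _ h2)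

/-- Write `L = u - v` with `u = c x_2` and `v = -(a x_0 + b x_1)`, and let `G = (u^m - v^m) / L`.
Then `F = x_0^e x_1 x_2 G` works: the power `u^m` needs only `x_2^m`, and `v^m` only the monomials
of degree `m` in `x_0, x_1`. -/
theorem isTogliatti_stripExponents {e m : ℕ} (hm : 0 < m) (he : 2 ≤ e) :
    IsTogliatti (e + m + 2) (monomialIdeal k (stripExponents e m)) := by
  refine isTogliatti_monomialIdeal (by omega) (fun a ha => degree_of_mem_stripExponents ha)
    (by rw [card_stripExponents hm]; omega)
    (forall_single_mem.2 (by simp [stripExponents, pureExponents])) fun L hL => ?_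
  -- For `L = 0` the form `G` below may vanish, but any nonzero form serves.
  by_cases hL0 : L = 0
  · exact ⟨X 0 ^ (e + m + 2 - 1), isHomogeneous_X_pow _ _, pow_ne_zero _ (X_ne_zero _), by
      simp [hL0]⟩
  obtain ⟨a, b, c, rfl⟩ := linear_form_eq hL
  let I := monomialIdeal k (stripExponents e m)
  let u : MvPolynomial (Fin (2 + 1)) k := C c * X 2
  let v : MvPolynomial (Fin (2 + 1)) k := -(C a * X 0 + C b * X 1)
  have hu : u.IsHomogeneous 1 := isHomogeneous_C_mul_X _ _
  have hv : v.IsHomogeneous 1 := ((isHomogeneous_C_mul_X _ _).add (isHomogeneous_C_mul_X _ _)).neg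
  let G := ∑ i ∈ Finset.range m, u ^ i * v ^ (m - 1 - i)
  have hLG : (C a * X 0 + C b * X 1 + C c * X 2) * G = u ^ m - v ^ m := by
    rw [← (Commute.all u v).mul_geom_sum₂ m]
    simp only [u, v, G]
    ring
  have hGhom : G.IsHomogeneous (m - 1) := by
    refine IsHomogeneous.sum _ _ _ fun i hi => ?_
    have := (hu.pow i).mul (hv.pow (m - 1 - i))
    rw [Finset.mem_range] at hi
    rwa [show 1 * i + 1 * (m - 1 - i) = m - 1 by omega] at this
  have hG0 : G ≠ 0 := by
    intro h0
    rw [h0, mul_zero] at hLG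
    -- If `u^m = v^m`, the three coordinate points give `a = b = c = 0`.
    have hev : ∀ x : Fin (2 + 1) → k, (c * x 2) ^ m - (-(a * x 0 + b * x 1)) ^ m = 0 := by
      intro x
      have := congrArg (eval x) hLG
      simpa [u, v] using this.symm
    have ha := hev ![1, 0, 0]
    have hb := hev ![0, 1, 0]
    have hc := hev ![0, 0, 1]
    simp [hm.ne'] at ha hb hc
    simp [ha, hb, hc] at hL0
  refine ⟨X 0 ^ e * X 1 * X 2 * G, ?_, ?_, ?_⟩
  · have := (((isHomogeneous_X_pow (R := k) (0 : Fin (2 + 1)) e).mul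
      (isHomogeneous_X k (1 : Fin (2 + 1)))).mul (isHomogeneous_X k (2 : Fin (2 + 1)))).mul hGhom
    rwa [show e + 1 + 1 + (m - 1) = e + m + 2 - 1 by omega] at this
  · exact mul_ne_zero (mul_ne_zero (mul_ne_zero (pow_ne_zero _ (X_ne_zero _)) (X_ne_zero _))
      (X_ne_zero _)) hG0
  · have h2 : (X 0 ^ e * X 1 * X 2) * u ^ m ∈ I := by
      have := monomial_mem_monomialIdeal (k := k) (show expo e 1 (1 + m) ∈ stripExponents e m from
        Finset.mem_union_left _ (mem_innerExponents.2 (Or.inl rfl)))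
      rw [monomial_expo] at this
      have h := Ideal.mul_mem_left I (C c ^ m) this
      convert h using 1
      simp only [u]
      ring
    have h1 : (X 0 ^ e * X 1 * X 2) * v ^ m ∈ I := by
      have hv' : v = C (-b) * X 1 + C (-a) * X 0 := by
        simp only [v, C_neg]
        ring
      rw [hv', add_pow, Finset.mul_sum]
      refine Ideal.sum_mem _ fun i hi => ?_
      rw [Finset.mem_range, Nat.lt_succ_iff] at hi
      have := monomial_mem_monomialIdeal (k := k)
        (show expo (e + (m - i)) (1 + i) 1 ∈ stripExponents e m from
          Finset.mem_union_left _ (mem_innerExponents.2 (Or.inr ⟨i, hi, rfl⟩)))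
      rw [monomial_expo] at this
      have h := Ideal.mul_mem_left I (C (-b) ^ i * C (-a) ^ (m - i) *
        (m.choose i : MvPolynomial (Fin (2 + 1)) k)) this
      convert h using 1
      ring
    have := Ideal.sub_mem _ h2 h1
    convert this using 1
    rw [← mul_sub, ← hLG]
    ring

/-- The only relation on the plane, up to scalar, is the one from `u^m - v^m`. On the points `(t, 1,
-1 - t)` the inner monomials are divisible by `t^e`, so for `e ≥ 2` the coefficient of `t` isolates
`c₂`. Once the pure powers are gone, cancelling `t^e (1 + t)` leaves `G = 0`, whose coefficients
determine the `b i`. -/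
theorem eq_zero_of_strip_relation [CharZero k] {e m : ℕ} (hm : 0 < m) (he : 2 ≤ e)
    {c₀ c₁ c₂ b' : k} {b : ℕ → k}
    (h : ∀ x y z : k, x + y + z = 0 →
      b' * (x ^ e * y ^ 1 * z ^ (1 + m)) +
        ∑ i ∈ Finset.range (m + 1), b i * (x ^ (e + (m - i)) * y ^ (1 + i) * z ^ 1) +
          (c₀ * x ^ (e + m + 2) + c₁ * y ^ (e + m + 2) + c₂ * z ^ (e + m + 2)) = 0) :
    (c₀ = 0 ∧ c₁ = 0 ∧ c₂ = 0) ∧ ∀ i ≤ m, b i = -(b' * (-1) ^ m * m.choose i) := by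
  set d := e + m + 2 with hd
  set G : Polynomial k := Polynomial.C (b' * (-1) ^ m) * (1 + Polynomial.X) ^ m +
    ∑ i ∈ Finset.range (m + 1), Polynomial.C (b i) * Polynomial.X ^ (m - i) with hG
  have hp : Polynomial.C c₁ + Polynomial.C c₀ * Polynomial.X ^ d +
      Polynomial.C (c₂ * (-1) ^ d) * (1 + Polynomial.X) ^ d =
        Polynomial.X ^ e * ((1 + Polynomial.X) * G) := by
    refine polynomial_eq_of_forall_eval fun t => ?_
    have := h t 1 (-(1 + t)) (by ring)
    rw [neg_one_add_pow, neg_one_add_pow t d] at this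
    simp only [hG, Polynomial.eval_add, Polynomial.eval_C, Polynomial.eval_mul,
      Polynomial.eval_pow, Polynomial.eval_X, Polynomial.eval_one, Polynomial.eval_finsetSum]
    have hsum : ∑ i ∈ Finset.range (m + 1), b i * (t ^ (e + (m - i)) * 1 ^ (1 + i) *
        (-(1 + t)) ^ 1) = -(t ^ e * (1 + t)) * ∑ i ∈ Finset.range (m + 1), b i * t ^ (m - i) := by
      rw [Finset.mul_sum]
      refine Finset.sum_congr rfl fun i _ => ?_
      rw [one_pow, pow_add]
      ring
    rw [hsum] at this
    simp only [one_pow] at this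
    linear_combination this
  have h1 := congrArg (Polynomial.coeff · 1) hp
  simp only [Polynomial.coeff_add, Polynomial.coeff_C_mul, Polynomial.coeff_X_pow,
    Polynomial.coeff_one_add_X_pow, Polynomial.coeff_C, Polynomial.coeff_X_pow_mul'] at h1
  have hd' : (d : k) ≠ 0 := by exact_mod_cast (by omega : d ≠ 0)
  have hc2 : c₂ = 0 := by
    simpa [show ¬ (1 = d) by omega, show ¬ (e ≤ 1) by omega, hd'] using h1
  have hd0 : d ≠ 0 := by omega
  have he0 : e ≠ 0 := by omega
  have h0 := h 1 0 (-1) (by ring)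
  have h2 := h 0 1 (-1) (by ring)
  simp [hd0, he0, hc2] at h0 h2
  subst h0 h2 hc2
  refine ⟨⟨rfl, rfl, rfl⟩, fun i hi => ?_⟩
  have hG0 : G = 0 := by
    have h1X : (1 + Polynomial.X : Polynomial k) ≠ 0 := by
      rw [add_comm]
      exact (Polynomial.monic_X_add_C (1 : k)).ne_zero
    have hp' : Polynomial.X ^ e * ((1 + Polynomial.X) * G) = 0 := by
      rw [← hp]
      simp
    exact ((mul_eq_zero.1 ((mul_eq_zero.1 hp').resolve_left
      (pow_ne_zero _ Polynomial.X_ne_zero))).resolve_left h1X)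
  have hco := congrArg (Polynomial.coeff · (m - i)) (hG.symm.trans hG0)
  simp only [Polynomial.coeff_add, Polynomial.coeff_C_mul, Polynomial.coeff_X_pow,
    Polynomial.coeff_one_add_X_pow, Polynomial.coeff_zero, Polynomial.finsetSum_coeff] at hco
  rw [Finset.sum_eq_single i, if_pos rfl, Nat.choose_symm hi] at hco
  · linear_combination hco
  · intro j hj hji
    rw [Finset.mem_range] at hj
    rw [if_neg (by omega), mul_zero]
  · intro hn
    exact absurd (Finset.mem_range.2 (by omega)) hn

theorem isMinimalMonomialTogliatti_cornerExponents [CharZero k] {d : ℕ} (hd : 4 ≤ d) :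
    IsMinimalMonomialTogliatti d (monomialIdeal k (cornerExponents d)) := by
  have hdeg := fun a (ha : a ∈ cornerExponents d) =>
    degree_of_mem_cornerExponents (by omega : 0 < d) ha
  refine ⟨cornerExponents d, hdeg, rfl, isTogliatti_cornerExponents hd, fun T hT hTog => ?_⟩
  have h5 := five_le_card_of_isTogliatti hd (fun a ha => hdeg a (hT.1 ha)) hTog
  have := Finset.card_lt_card hT
  rw [card_cornerExponents (by omega)] at this
  omega

/-- A smaller system `T` keeps the pure powers, so it omits an inner monomial. All inner
coefficients of a relation are nonzero multiples of `b'`, so one vanishing coefficient makes the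
relation trivial. -/
theorem isMinimalMonomialTogliatti_stripExponents [CharZero k] {e m : ℕ} (hm : 0 < m)
    (he : 2 ≤ e) :
    IsMinimalMonomialTogliatti (e + m + 2) (monomialIdeal k (stripExponents e m)) := by
  classical
  refine ⟨stripExponents e m, fun a ha => degree_of_mem_stripExponents ha, rfl,
    isTogliatti_stripExponents hm he, fun T hT hTog => ?_⟩
  have hdeg : ∀ a ∈ T, a.degree = e + m + 2 := fun a ha => degree_of_mem_stripExponents (hT.1 ha)
  have hpure := pureExponents_subset hdeg hTog
  obtain ⟨s, hs, hsT⟩ := Finset.exists_of_ssubset hT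
  refine not_failsWLP_of_linearIndependent (by omega) hdeg (fun c hc => ?_) hTog.2.2
  -- Extension by zero turns a relation on `T` into one on all of `stripExponents e m`.
  let c' : (Fin (2 + 1) →₀ ℕ) → k := fun a => if a ∈ T then c a else 0
  have hc's : c' s = 0 := if_neg hsT
  have hrel := eq_zero_of_strip_relation (k := k) (e := e) (m := m) hm he
    (c₀ := c' (expo (e + m + 2) 0 0)) (c₁ := c' (expo 0 (e + m + 2) 0))
    (c₂ := c' (expo 0 0 (e + m + 2))) (b' := c' (expo e 1 (1 + m)))
    (b := fun i => c' (expo (e + (m - i)) (1 + i) 1)) fun x y z hxyz => by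
      have h := hc ![x, y, z] ((sum_univ_eq _).trans hxyz)
      have h' : ∑ a ∈ stripExponents e m, c' a * (x ^ a 0 * y ^ a 1 * z ^ a 2) = 0 := by
        rw [← h, ← Finset.sum_subset hT.1]
        · refine Finset.sum_congr rfl fun a ha => ?_
          rw [prod_pow_eq]
          simp [c', ha]
        · intro a _ ha
          simp [c', ha]
      rw [stripExponents, Finset.sum_union (disjoint_inner_pure _ _ _), sum_innerExponents hm,
        sum_pureExponents (by omega)] at h'
      simp only [expo_zero, expo_one, expo_two] at h'
      rw [← h']
      ring
  obtain ⟨⟨h0, h1, h2⟩, hb⟩ := hrel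
  have hb' : c' (expo e 1 (1 + m)) = 0 := by
    rw [stripExponents, Finset.mem_union, mem_innerExponents] at hs
    rcases hs with (rfl | ⟨i, hi, rfl⟩) | hs
    · exact hc's
    · have := hb i hi
      rw [hc's, eq_comm, neg_eq_zero, mul_eq_zero, mul_eq_zero] at this
      rcases this with (h | h) | h
      · exact h
      · exact absurd h (pow_ne_zero _ (by norm_num))
      · exact absurd h (by exact_mod_cast (Nat.choose_pos hi).ne')
    · exact absurd (hpure hs) hsT
  have hall : ∀ a ∈ stripExponents e m, c' a = 0 := by
    intro a ha
    rw [stripExponents, Finset.mem_union, mem_innerExponents] at ha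
    rcases ha with (rfl | ⟨i, hi, rfl⟩) | ha
    · exact hb'
    · rw [hb i hi, hb']
      ring
    · simp only [pureExponents, Finset.mem_insert, Finset.mem_singleton] at ha
      rcases ha with rfl | rfl | rfl
      exacts [h0, h1, h2]
  intro a ha
  have := hall a (hT.1 ha)
  simpa [c', ha] using this

theorem explicitIdeal_five (d : ℕ) :
    explicitIdeal k d 5 = monomialIdeal k (cornerExponents d) := by
  rw [explicitIdeal, if_pos rfl, ← Ideal.span_union, monomialIdeal]
  congr 1
  simp only [cornerExponents, pureExponents, Finset.coe_insert, Finset.coe_singleton,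
    Set.image_insert_eq, Set.image_singleton, monomial_expo, pow_zero, pow_one, mul_one, one_mul]
  ext p
  simp only [Set.mem_union, Set.mem_insert_iff, Set.mem_singleton_iff]
  tauto

theorem explicitIdeal_strip {e m : ℕ} (hm : 0 < m) :
    explicitIdeal k (e + m + 2) (m + 5) = monomialIdeal k (stripExponents e m) := by
  rw [explicitIdeal, if_neg (by omega), Ideal.span_mul_span', ← Ideal.span_union, monomialIdeal,
    show e + m + 2 + 3 - (m + 5) = e by omega, Nat.add_sub_cancel]
  congr 1
  rw [stripExponents, Finset.coe_union, Set.image_union, Set.union_comm]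
  congr 1
  · ext p
    simp only [Set.singleton_mul, Set.mem_image, Set.mem_union, Set.mem_ofPred_eq,
      Set.mem_singleton_iff, Finset.mem_coe, mem_innerExponents]
    constructor
    · rintro ⟨_, ⟨i, j, hij, rfl⟩ | rfl, rfl⟩
      · refine ⟨_, Or.inr ⟨j, by omega, rfl⟩, ?_⟩
        rw [monomial_expo, show m - j = i by omega]
        ring
      · refine ⟨_, Or.inl rfl, ?_⟩
        rw [monomial_expo]
        ring
    · rintro ⟨_, rfl | ⟨i, hi, rfl⟩, rfl⟩
      · refine ⟨_, Or.inr rfl, ?_⟩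
        rw [monomial_expo]
        ring
      · refine ⟨_, Or.inl ⟨m - i, i, by omega, rfl⟩, ?_⟩
        rw [monomial_expo]
        ring
  · simp only [pureExponents, Finset.coe_insert, Finset.coe_singleton,
      Set.image_insert_eq, Set.image_singleton, monomial_expo, pow_zero, mul_one, one_mul]

/-! ### Directional derivatives of polynomials -/

/-- The derivative of `f` at `y` in the direction `v`. -/
def dirDeriv {σ : Type*} [Fintype σ] (y v : σ → k) (f : MvPolynomial σ k) : k :=
  ∑ a, eval y (pderiv a f) * v a

section dirDeriv

variable {σ τ : Type*} [Fintype σ] [Fintype τ] (y v : σ → k)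

theorem dirDeriv_add (f g : MvPolynomial σ k) :
    dirDeriv y v (f + g) = dirDeriv y v f + dirDeriv y v g := by
  simp [dirDeriv, add_mul, Finset.sum_add_distrib]

theorem dirDeriv_sub (f g : MvPolynomial σ k) :
    dirDeriv y v (f - g) = dirDeriv y v f - dirDeriv y v g := by
  simp [dirDeriv, sub_mul, Finset.sum_sub_distrib]

theorem dirDeriv_mul (f g : MvPolynomial σ k) :
    dirDeriv y v (f * g) = eval y f * dirDeriv y v g + eval y g * dirDeriv y v f := by
  simp only [dirDeriv, Finset.mul_sum, ← Finset.sum_add_distrib]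
  refine Finset.sum_congr rfl fun a _ => ?_
  rw [pderiv_mul, map_add, map_mul, map_mul]
  ring

theorem dirDeriv_C (c : k) : dirDeriv y v (C c) = 0 := by
  simp [dirDeriv]

theorem dirDeriv_X (a : σ) : dirDeriv y v (X a) = v a := by
  classical
  rw [dirDeriv, Finset.sum_eq_single a]
  · simp
  · intro b _ hb
    rw [pderiv_X_of_ne hb.symm]
    simp
  · simp

theorem dirDeriv_pow_of_eq_zero {f : MvPolynomial σ k} (h : dirDeriv y v f = 0) (m : ℕ) :
    dirDeriv y v (f ^ m) = 0 := by
  induction m with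
  | zero => rw [pow_zero, ← C_1, dirDeriv_C]
  | succ m ih => rw [pow_succ, dirDeriv_mul, ih, h, mul_zero, mul_zero, add_zero]

theorem eval_aeval {σ τ : Type*} (y : σ → k) (g : τ → MvPolynomial σ k) (f : MvPolynomial τ k) :
    eval y (aeval g f) = eval (fun a => eval y (g a)) f := by
  induction f using MvPolynomial.induction_on with
  | C c => rw [aeval_C, algebraMap_eq, eval_C, eval_C]
  | add p q hp hq => rw [map_add, map_add, map_add, hp, hq]
  | mul_X p a hp => rw [map_mul, map_mul, map_mul, hp, aeval_X, eval_X]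

/-- The chain rule; it carries tangent vectors of a parametrization to tangent vectors of the cone.
-/
theorem dirDeriv_aeval (g : τ → MvPolynomial σ k) (f : MvPolynomial τ k) :
    dirDeriv y v (aeval g f) =
      dirDeriv (fun a => eval y (g a)) (fun a => dirDeriv y v (g a)) f := by
  induction f using MvPolynomial.induction_on with
  | C c => simp [dirDeriv_C, algebraMap_eq]
  | add p q hp hq => rw [map_add, dirDeriv_add, dirDeriv_add, hp, hq]
  | mul_X p a hp =>
    rw [map_mul, aeval_X, dirDeriv_mul, dirDeriv_mul, hp, eval_aeval, dirDeriv_X, eval_X]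

end dirDeriv

theorem mem_tangentSpace_iff {A : Finset (Fin (n + 1) →₀ ℕ)} {y v : A → k} :
    v ∈ tangentSpace A y ↔ ∀ f ∈ coneIdeal k A, dirDeriv y v f = 0 := Iff.rfl

/-! ### Monomial charts of the affine cone -/

theorem mem_coneIdeal_iff {A : Finset (Fin (n + 1) →₀ ℕ)} {f : MvPolynomial A k} :
    f ∈ coneIdeal k A ↔ ∀ x, eval (monomialMap A x) f = 0 := by
  simp [coneIdeal, mem_vanishingIdeal_iff, aeval_eq_eval]

/-- The monomials `x^a` of `A` are monomials in `x^{w_0}`, `x^{w_1} / x^{w_0}`,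
`x^{w_2} / x^{w_0}`, of degrees `1`, `p a`, `q a`, and these three are coordinates on a
three-dimensional torus. -/
structure IsChart (k : Type*) [Field k] (A : Finset (Fin (n + 1) →₀ ℕ)) (w : Fin 3 → A)
    (p q : A → ℕ) : Prop where
  rel : ∀ a : A, (a : Fin (n + 1) →₀ ℕ) + (p a + q a) • (w 0 : Fin (n + 1) →₀ ℕ) =
    w 0 + p a • (w 1 : Fin (n + 1) →₀ ℕ) + q a • (w 2 : Fin (n + 1) →₀ ℕ)
  p_zero : p (w 0) = 0
  q_zero : q (w 0) = 0
  p_one : p (w 1) = 1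
  q_one : q (w 1) = 0
  p_two : p (w 2) = 0
  q_two : q (w 2) = 1
  torus : ∀ c : Fin 3 → k, (∀ i, c i ≠ 0) → ∃ x, ∀ i, monomialMap A x (w i) = c i

theorem monomialMap_eq {A : Finset (Fin (n + 1) →₀ ℕ)} (x : Fin (n + 1) → k) (a : A) :
    monomialMap A x a = ∏ i, x i ^ (a : Fin (n + 1) →₀ ℕ) i := rfl

namespace IsChart

variable {A : Finset (Fin (n + 1) →₀ ℕ)} {w : Fin 3 → A} {p q : A → ℕ}

theorem monomialMap_rel (h : IsChart k A w p q) (x : Fin (n + 1) → k) (a : A) :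
    monomialMap A x a * monomialMap A x (w 0) ^ (p a + q a) =
      monomialMap A x (w 0) * monomialMap A x (w 1) ^ p a * monomialMap A x (w 2) ^ q a := by
  simp only [monomialMap_eq, ← Finset.prod_pow, ← Finset.prod_mul_distrib]
  refine Finset.prod_congr rfl fun i _ => ?_
  have := DFunLike.congr_fun (h.rel a) i
  simp only [Finsupp.add_apply, Finsupp.smul_apply, smul_eq_mul] at this
  rw [← pow_mul, ← pow_mul, ← pow_mul, ← pow_add, ← pow_add, ← pow_add, mul_comm _ (p a + q a),
    this, mul_comm (p a), mul_comm (q a)]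

theorem binomial_mem (h : IsChart k A w p q) (a : A) :
    (X a * X (w 0) ^ (p a + q a) - X (w 0) * X (w 1) ^ p a * X (w 2) ^ q a : MvPolynomial A k) ∈
      coneIdeal k A := by
  rw [mem_coneIdeal_iff]
  intro x
  simp [h.monomialMap_rel x a]

/-- The parametrization of the chart. -/
def param (k : Type*) [Field k] (p q : A → ℕ) (a : A) : MvPolynomial (Fin 3) k :=
  X 0 * X 1 ^ p a * X 2 ^ q a

theorem eq_zero_of_forall_eval_torus [Infinite k] {f : MvPolynomial (Fin 3) k}
    (h : ∀ c : Fin 3 → k, (∀ i, c i ≠ 0) → eval c f = 0) : f = 0 := by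
  refine funext_set (fun _ => {0}ᶜ) (fun _ => (Set.finite_singleton (0 : k)).infinite_compl)
    fun c hc => ?_
  rw [map_zero]
  exact h c fun i => hc i (Set.mem_univ i)

/-- On the torus, the parametrization takes values in the image of `monomialMap`, and a polynomial
vanishing on the torus is zero over an infinite field. -/
theorem aeval_param_eq_zero [Infinite k] (h : IsChart k A w p q) {f : MvPolynomial A k}
    (hf : f ∈ coneIdeal k A) : aeval (param k p q) f = 0 := by
  refine eq_zero_of_forall_eval_torus fun c hc => ?_
  obtain ⟨x, hx⟩ := h.torus ![c 0, c 0 * c 1, c 0 * c 2] fun i => by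
    fin_cases i <;> simp [hc]
  have h0 : monomialMap A x (w 0) = c 0 := hx 0
  have h1 : monomialMap A x (w 1) = c 0 * c 1 := hx 1
  have h2 : monomialMap A x (w 2) = c 0 * c 2 := hx 2
  have hpt : (fun a => eval c (param k p q a)) = monomialMap A x := by
    funext a
    have := h.monomialMap_rel x a
    rw [h0, h1, h2] at this
    apply mul_right_cancel₀ (pow_ne_zero (p a + q a) (hc 0))
    rw [this, param]
    simp only [map_mul, map_pow, eval_X]
    rw [mul_pow, mul_pow, pow_add]
    ring
  rw [eval_aeval, hpt]
  exact mem_coneIdeal_iff.1 hf x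

theorem param_eval_eq (h : IsChart k A w p q) {y : A → k} (hy : y ∈ zeroLocus k (coneIdeal k A))
    (h0 : y (w 0) ≠ 0) (a : A) :
    eval ![y (w 0), y (w 1) / y (w 0), y (w 2) / y (w 0)] (param k p q a) = y a := by
  have := mem_zeroLocus_iff.1 hy _ (h.binomial_mem a)
  simp only [map_sub, map_mul, map_pow, aeval_X, sub_eq_zero] at this
  apply mul_right_cancel₀ (pow_ne_zero (p a + q a) h0)
  rw [this]
  simp only [param, map_mul, map_pow, eval_X]
  simp only [Matrix.cons_val]
  rw [div_pow, div_pow, pow_add]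
  field_simp

/-- The coordinates of a tangent vector in the directions `w_0`, `w_1`, `w_2`. -/
def tangentCoords (w : Fin 3 → A) (y : A → k) : tangentSpace A y →ₗ[k] (Fin 3 → k) where
  toFun v i := v.1 (w i)
  map_add' _ _ := rfl
  map_smul' _ _ := rfl

/-- Differentiating the binomial for `a` along a vector that vanishes at the three `w i` leaves `y
(w 0) ^ (p a + q a) * v a = 0`. -/
theorem tangentCoords_injective (h : IsChart k A w p q) {y : A → k} (h0 : y (w 0) ≠ 0) :
    Function.Injective (tangentCoords w y) := by
  rw [injective_iff_map_eq_zero]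
  intro v hv
  have hw : ∀ i, dirDeriv y v.1 (X (w i)) = 0 := fun i => by
    rw [dirDeriv_X]
    exact congrFun hv i
  ext a
  have := mem_tangentSpace_iff.1 v.2 _ (h.binomial_mem a)
  rw [dirDeriv_sub, dirDeriv_mul, dirDeriv_mul, dirDeriv_mul,
    dirDeriv_pow_of_eq_zero y v.1 (hw 0), dirDeriv_pow_of_eq_zero y v.1 (hw 1),
    dirDeriv_pow_of_eq_zero y v.1 (hw 2), hw 0, dirDeriv_X] at this
  simpa [h0] using this

theorem tangentCoords_surjective [Infinite k] (h : IsChart k A w p q) {y : A → k}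
    (hy : y ∈ zeroLocus k (coneIdeal k A)) (h0 : y (w 0) ≠ 0) :
    Function.Surjective (tangentCoords w y) := by
  intro u
  let s : Fin 3 → k := ![y (w 0), y (w 1) / y (w 0), y (w 2) / y (w 0)]
  -- The preimage of `u` under the differential at `s` of `(X_0, X_0 X_1, X_0 X_2)`, the components
  -- of the parametrization at the `w i`.
  let u' : Fin 3 → k := ![u 0, (u 1 - u 0 * (y (w 1) / y (w 0))) / y (w 0),
    (u 2 - u 0 * (y (w 2) / y (w 0))) / y (w 0)]
  refine ⟨⟨fun a => dirDeriv s u' (param k p q a), ?_⟩, ?_⟩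
  · rw [mem_tangentSpace_iff]
    intro f hf
    have := dirDeriv_aeval s u' (param k p q) f
    rw [h.aeval_param_eq_zero hf, ← C_0, dirDeriv_C] at this
    rw [this]
    congr 1
    funext a
    exact (h.param_eval_eq hy h0 a).symm
  · funext i
    change dirDeriv s u' (param k p q (w i)) = u i
    fin_cases i
    · simp [param, h.p_zero, h.q_zero, dirDeriv_X, u']
    · simp [param, h.p_one, h.q_one, dirDeriv_mul, dirDeriv_X, u', s]
      field_simp
      ring
    · simp [param, h.p_two, h.q_two, dirDeriv_mul, dirDeriv_X, u', s]
      field_simp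
      ring

theorem rank_tangentSpace [Infinite k] (h : IsChart k A w p q) {y : A → k}
    (hy : y ∈ zeroLocus k (coneIdeal k A)) (h0 : y (w 0) ≠ 0) :
    Module.rank k (tangentSpace A y) = 3 := by
  rw [(LinearEquiv.ofBijective (tangentCoords w y)
    ⟨h.tangentCoords_injective h0, h.tangentCoords_surjective hy h0⟩).rank_eq]
  simp

/-- A polynomial relation between the three chart coordinates would vanish on the whole torus. -/
theorem three_le_trdeg [Infinite k] (h : IsChart k A w p q) :
    3 ≤ Algebra.trdeg k (MvPolynomial A k ⧸ coneIdeal k A) := by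
  have hind : AlgebraicIndependent k
      (fun i => Ideal.Quotient.mkₐ k (coneIdeal k A) (X (w i))) := by
    rw [AlgebraicIndependent, injective_iff_map_eq_zero]
    intro g hg
    have hg' : rename w g ∈ coneIdeal k A := by
      rw [← Ideal.Quotient.eq_zero_iff_mem, ← Ideal.Quotient.mkₐ_eq_mk k, ← hg]
      have : (Ideal.Quotient.mkₐ k (coneIdeal k A)).comp (rename w) =
          aeval fun i => Ideal.Quotient.mkₐ k (coneIdeal k A) (X (w i)) := by
        ext i
        simp
      exact DFunLike.congr_fun this g
    refine eq_zero_of_forall_eval_torus fun c hc => ?_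
    obtain ⟨x, hx⟩ := h.torus c hc
    have := mem_coneIdeal_iff.1 hg' x
    rwa [eval_rename, show monomialMap A x ∘ w = c from funext hx] at this
  have := hind.lift_cardinalMk_le_trdeg
  simpa using this

end IsChart

/-- The cone ideal is the kernel of `X_a ↦ x^a`, so the coordinate ring embeds in a polynomial ring
in `n + 1` variables. -/
theorem trdeg_le [Infinite k] (A : Finset (Fin (n + 1) →₀ ℕ)) :
    Algebra.trdeg k (MvPolynomial A k ⧸ coneIdeal k A) ≤ (n + 1 : ℕ) := by
  let φ : MvPolynomial A k →ₐ[k] MvPolynomial (Fin (n + 1)) k :=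
    aeval fun a : A => monomial (a : Fin (n + 1) →₀ ℕ) (1 : k)
  have hφ : ∀ f x, eval x (φ f) = eval (monomialMap A x) f := by
    intro f x
    induction f using MvPolynomial.induction_on with
    | C c => simp [φ, algebraMap_eq]
    | add p q hp hq => simp [hp, hq]
    | mul_X p a hp =>
      rw [map_mul, map_mul, map_mul, hp, eval_X]
      simp [φ, monomialMap_eq, eval_monomial, Finsupp.prod_fintype]
  have hker : ∀ f, f ∈ coneIdeal k A ↔ φ f = 0 := by
    intro f
    rw [mem_coneIdeal_iff]
    constructor
    · intro h
      refine MvPolynomial.funext fun x => ?_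
      rw [hφ, h, map_zero]
    · intro h x
      rw [← hφ, h, map_zero]
  let ψ : (MvPolynomial A k ⧸ coneIdeal k A) →ₐ[k] MvPolynomial (Fin (n + 1)) k :=
    Ideal.Quotient.liftₐ _ φ fun f hf => (hker f).1 hf
  have hinj : Function.Injective ψ := by
    rw [injective_iff_map_eq_zero]
    intro u hu
    obtain ⟨f, rfl⟩ := Ideal.Quotient.mk_surjective u
    rw [Ideal.Quotient.eq_zero_iff_mem, hker]
    exact hu
  refine (trdeg_le_of_injective ψ hinj).trans ?_
  rw [MvPolynomial.trdeg_of_isDomain]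
  simp

theorem isSmoothToric_of_charts [Infinite k] {A : Finset (Fin (2 + 1) →₀ ℕ)}
    (h : ∀ y ∈ zeroLocus k (coneIdeal k A), y ≠ 0 →
      ∃ w p q, IsChart k A w p q ∧ y (w 0) ≠ 0) : IsSmoothToric k A := by
  intro y hy hy0
  obtain ⟨w, p, q, hw, h0⟩ := h y hy hy0
  rw [hw.rank_tangentSpace hy h0]
  exact le_antisymm hw.three_le_trdeg (trdeg_le A)

/-! ### Hexagons -/

/-- The exponent with entries `a`, `b`, `c` at the positions `i`, `j`, `l`. -/
def expoAt (i j l : Fin (2 + 1)) (a b c : ℕ) : Fin (2 + 1) →₀ ℕ :=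
  Finsupp.single i a + Finsupp.single j b + Finsupp.single l c

theorem eq_or_eq_or_eq : ∀ {i j l : Fin (2 + 1)}, i ≠ j → i ≠ l → j ≠ l →
    ∀ x, x = i ∨ x = j ∨ x = l := by decide

theorem exists_complement : ∀ i : Fin (2 + 1), ∃ j l, i ≠ j ∧ i ≠ l ∧ j ≠ l := by decide

section expoAt

variable {i j l : Fin (2 + 1)}

theorem expoAt_fst (hij : i ≠ j) (hil : i ≠ l) (a b c : ℕ) : expoAt i j l a b c i = a := by
  simp [expoAt, hij.symm, hil.symm]

theorem expoAt_snd (hij : i ≠ j) (hjl : j ≠ l) (a b c : ℕ) : expoAt i j l a b c j = b := by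
  simp [expoAt, hij, hjl.symm]

theorem expoAt_trd (hil : i ≠ l) (hjl : j ≠ l) (a b c : ℕ) : expoAt i j l a b c l = c := by
  simp [expoAt, hil, hjl]

theorem ext_at (hij : i ≠ j) (hil : i ≠ l) (hjl : j ≠ l) {a b : Fin (2 + 1) →₀ ℕ}
    (hi : a i = b i) (hj : a j = b j) (hl : a l = b l) : a = b := by
  ext x
  rcases eq_or_eq_or_eq hij hil hjl x with rfl | rfl | rfl
  exacts [hi, hj, hl]

theorem univ_eq_at (hij : i ≠ j) (hil : i ≠ l) (hjl : j ≠ l) :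
    (Finset.univ : Finset (Fin (2 + 1))) = {i, j, l} := by
  ext x
  simpa using eq_or_eq_or_eq hij hil hjl x

theorem degree_eq_add_at (hij : i ≠ j) (hil : i ≠ l) (hjl : j ≠ l) (a : Fin (2 + 1) →₀ ℕ) :
    a.degree = a i + a j + a l := by
  rw [Finsupp.degree_eq_sum, univ_eq_at hij hil hjl, Finset.sum_insert (by simp [hij, hil]),
    Finset.sum_insert (by simp [hjl]), Finset.sum_singleton, add_assoc]

theorem prod_pow_eq_at (hij : i ≠ j) (hil : i ≠ l) (hjl : j ≠ l) (x : Fin (2 + 1) → k)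
    (a : Fin (2 + 1) →₀ ℕ) : ∏ t, x t ^ a t = x i ^ a i * x j ^ a j * x l ^ a l := by
  rw [univ_eq_at hij hil hjl, Finset.prod_insert (by simp [hij, hil]),
    Finset.prod_insert (by simp [hjl]), Finset.prod_singleton, mul_assoc]

end expoAt

/-- `A` consists of exponents of degree `d` in the hexagon `x_i ≤ d - h i`, contains all those on
the sides of the triangle, and near each vertex of the hexagon the adjacent ones. -/
structure IsHexagon (d : ℕ) (h : Fin (2 + 1) → ℕ) (A : Finset (Fin (2 + 1) →₀ ℕ)) : Prop where
  degree_eq : ∀ a ∈ A, a.degree = d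
  add_le : ∀ a ∈ A, ∀ i, a i + h i ≤ d
  mem_of_eq_zero : ∀ a : Fin (2 + 1) →₀ ℕ, a.degree = d → (∀ i, a i + h i ≤ d) →
    (∃ i, a i = 0) → a ∈ A
  adjacent_mem : ∀ i j l, i ≠ j → i ≠ l → j ≠ l → expoAt i j l 1 (h l - 1) (d - h l) ∈ A
  one_le : ∀ i, 1 ≤ h i
  add_lt : ∀ i j, i ≠ j → h i + h j < d
  one_eq : h 1 = 1
  two_eq : h 2 = 1

namespace IsHexagon

variable {d : ℕ} {h : Fin (2 + 1) → ℕ} {A : Finset (Fin (2 + 1) →₀ ℕ)} {i j l : Fin (2 + 1)}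

theorem side_mem (H : IsHexagon d h A) (hij : i ≠ j) (hil : i ≠ l) (hjl : j ≠ l) {b c : ℕ}
    (hbc : b + c = d) (hb : b + h j ≤ d) (hc : c + h l ≤ d) : expoAt i j l 0 b c ∈ A := by
  refine H.mem_of_eq_zero _ ?_ (fun t => ?_) ⟨i, expoAt_fst hij hil _ _ _⟩
  · rw [degree_eq_add_at hij hil hjl, expoAt_fst hij hil, expoAt_snd hij hjl, expoAt_trd hil hjl]
    omega
  · rcases eq_or_eq_or_eq hij hil hjl t with rfl | rfl | rfl
    · rw [expoAt_fst hij hil]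
      have := H.add_lt _ _ hij
      omega
    · rwa [expoAt_snd hij hjl]
    · rwa [expoAt_trd hil hjl]

theorem vertex_mem (H : IsHexagon d h A) (hij : i ≠ j) (hil : i ≠ l) (hjl : j ≠ l) :
    expoAt i j l 0 (h l) (d - h l) ∈ A := by
  have h1 := H.add_lt _ _ hjl
  exact H.side_mem hij hil hjl (by omega) (by omega) (by omega)

theorem next_mem (H : IsHexagon d h A) (hij : i ≠ j) (hil : i ≠ l) (hjl : j ≠ l) :
    expoAt i j l 0 (h l + 1) (d - h l - 1) ∈ A := by
  have h1 := H.add_lt _ _ hjl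
  exact H.side_mem hij hil hjl (by omega) (by omega) (by omega)

/-- From the vertex `(0, h_l, d - h_l)` the two edge directions are `(1, -1, 0)` and `(0, 1, -1)`.
They form a basis of the exponent vectors of degree zero, and the two inequalities `a_i ≥ 0`, `a_l ≤
d - h_l` say that both coefficients are nonnegative. -/
theorem isChart [IsAlgClosed k] (H : IsHexagon d h A) (hij : i ≠ j) (hil : i ≠ l) (hjl : j ≠ l) :
    IsChart k A ![⟨_, H.vertex_mem hij hil hjl⟩, ⟨_, H.adjacent_mem i j l hij hil hjl⟩,
      ⟨_, H.next_mem hij hil hjl⟩] (fun a => a.1 i) (fun a => d - h l - a.1 l) := by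
  have h1 := H.add_lt _ _ hjl
  have h2 := H.one_le l
  constructor
  · intro a
    have hdeg := H.degree_eq a.1 a.2
    have hle := H.add_le a.1 a.2 l
    rw [degree_eq_add_at hij hil hjl] at hdeg
    obtain ⟨q, hq⟩ : ∃ q, d = a.1 l + h l + q := ⟨d - (a.1 l + h l), by omega⟩
    obtain ⟨r, hr⟩ : ∃ r, h l = r + 1 := ⟨h l - 1, by omega⟩
    have hq' : d - h l - a.1 l = q := by omega
    have e1 : d - h l = a.1 l + q := by omega
    have hj : a.1 j + a.1 i = r + 1 + q := by omega
    have e2 : a.1 l + q = (a.1 l + q - 1) + 1 := by omega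
    simp only [Matrix.cons_val, hq']
    apply ext_at hij hil hjl
    · simp only [Finsupp.add_apply, Finsupp.smul_apply, smul_eq_mul, expoAt_fst hij hil]
      ring
    · simp only [Finsupp.add_apply, Finsupp.smul_apply, smul_eq_mul, expoAt_snd hij hjl]
      rw [hr, Nat.add_sub_cancel]
      linear_combination hj
    · simp only [Finsupp.add_apply, Finsupp.smul_apply, smul_eq_mul, expoAt_trd hil hjl]
      rw [e1]
      obtain ⟨s, hs⟩ : ∃ s, a.1 l + q = s + 1 := ⟨a.1 l + q - 1, by omega⟩
      rw [hs, Nat.add_sub_cancel]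
      linear_combination hs
  · simp [expoAt_fst hij hil]
  · simp [expoAt_trd hil hjl]
  · simp [expoAt_fst hij hil]
  · simp [expoAt_trd hil hjl]
  · simp [expoAt_fst hij hil]
  · simp [expoAt_trd hil hjl]
    omega
  · intro c hc
    -- The three monomials force `x_l / x_j = c 0 / c 2` and `x_i / x_j = c 1 / c 0`; the scale `x_j
    -- = z` then solves `z^d s^(d - h_l) = c 0`, for which a `d`-th root is needed.
    let s := c 0 / c 2
    have hs : s ≠ 0 := div_ne_zero (hc 0) (hc 2)
    obtain ⟨z, hz⟩ := IsAlgClosed.exists_pow_nat_eq (c 0 / s ^ (d - h l)) (by omega : 0 < d)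
    have hz' : z ^ d * s ^ (d - h l) = c 0 := by
      rw [hz]
      exact div_mul_cancel₀ _ (pow_ne_zero _ hs)
    let x : Fin (2 + 1) → k := fun t => if t = i then c 1 / c 0 * z else if t = j then z else z * s
    have hxi : x i = c 1 / c 0 * z := if_pos rfl
    have hxj : x j = z := by simp [x, hij.symm]
    have hxl : x l = z * s := by simp [x, hil.symm, hjl.symm]
    refine ⟨x, fun t => ?_⟩
    rw [monomialMap_eq, prod_pow_eq_at hij hil hjl, hxi, hxj, hxl]
    fin_cases t
    · simp only [Matrix.cons_val, Fin.zero_eta, expoAt_fst hij hil,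
        expoAt_snd hij hjl, expoAt_trd hil hjl]
      rw [← hz', pow_zero, one_mul, mul_pow, ← mul_assoc, ← pow_add]
      congr 2
      omega
    · simp only [Matrix.cons_val, Fin.mk_one, expoAt_fst hij hil,
        expoAt_snd hij hjl, expoAt_trd hil hjl]
      have : c 1 / c 0 * (z ^ d * s ^ (d - h l)) = c 1 := by
        rw [hz']
        exact div_mul_cancel₀ _ (hc 0)
      have hzd : z ^ d = z * z ^ (h l - 1) * z ^ (d - h l) := by
        rw [← pow_succ', ← pow_add]
        congr 1
        omega
      refine Eq.trans ?_ this
      rw [hzd, mul_pow, pow_one]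
      ring
    · simp only [Matrix.cons_val, Fin.reduceFinMk, expoAt_fst hij hil,
        expoAt_snd hij hjl, expoAt_trd hil hjl]
      apply mul_right_cancel₀ hs
      rw [show c 2 * s = c 0 from mul_div_cancel₀ _ (hc 2), ← hz']
      obtain ⟨r, hr⟩ : ∃ r, d = h l + 1 + r := ⟨d - (h l + 1), by omega⟩
      rw [hr, show h l + 1 + r - h l - 1 = r by omega, show h l + 1 + r - h l = r + 1 by omega]
      ring

/-- If an exponent lies on the segment between two others, a nonzero coordinate there forces one at
an endpoint. A nonzero coordinate is thus moved first to a side of the triangle, then to a vertex of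
the hexagon. -/
theorem exists_chart_ne_zero (H : IsHexagon d h A) {y : A → k}
    (hy : y ∈ zeroLocus k (coneIdeal k A)) (hy0 : y ≠ 0) :
    ∃ i j l, ∃ (hij : i ≠ j) (hil : i ≠ l) (hjl : j ≠ l),
      y ⟨_, H.vertex_mem hij hil hjl⟩ ≠ 0 := by
  have hbin : ∀ (a b c : A) (p q : ℕ), 0 < p + q →
      (p + q) • (a : Fin (2 + 1) →₀ ℕ) = p • (b : Fin (2 + 1) →₀ ℕ) + q • (c : Fin (2 + 1) →₀ ℕ) →
        y a ≠ 0 → y b ≠ 0 ∨ y c ≠ 0 := by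
    intro a b c p q hpq habc ha
    by_contra hcon
    push Not at hcon
    have hmem : (X a ^ (p + q) - X b ^ p * X c ^ q : MvPolynomial A k) ∈ coneIdeal k A := by
      rw [mem_coneIdeal_iff]
      intro x
      simp only [map_sub, map_mul, map_pow, eval_X, sub_eq_zero, monomialMap_eq,
        ← Finset.prod_pow, ← Finset.prod_mul_distrib, ← pow_mul, ← pow_add]
      refine Finset.prod_congr rfl fun t _ => ?_
      have := DFunLike.congr_fun habc t
      simp only [Finsupp.add_apply, Finsupp.smul_apply, smul_eq_mul] at this
      rw [mul_comm, this, mul_comm p, mul_comm q]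
    have := mem_zeroLocus_iff.1 hy _ hmem
    simp only [map_sub, map_mul, map_pow, aeval_X, sub_eq_zero, hcon.1, hcon.2, ← pow_add,
      zero_pow hpq.ne'] at this
    exact pow_ne_zero _ ha this
  obtain ⟨a, ha⟩ : ∃ a, y a ≠ 0 := by
    by_contra hcon
    push Not at hcon
    exact hy0 (_root_.funext hcon)
  have hside : ∃ b : A, y b ≠ 0 ∧ ∃ i, b.1 i = 0 := by
    by_cases ha0 : a.1 0 = 0
    · exact ⟨a, ha, 0, ha0⟩
    have hdeg := H.degree_eq a.1 a.2
    rw [degree_eq_add] at hdeg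
    have hle := H.add_le a.1 a.2 0
    have h0 := H.one_le 0
    have h1 := H.one_eq
    have h2 := H.two_eq
    have d20 : (2 : Fin (2 + 1)) ≠ 0 := by decide
    have d21 : (2 : Fin (2 + 1)) ≠ 1 := by decide
    have d01 : (0 : Fin (2 + 1)) ≠ 1 := by decide
    -- The endpoints of the segment through `a` with constant `x_0`. They lie in the hexagon because
    -- `h 1 = h 2 = 1` and `a 0 ≥ 1`.
    have hb : expoAt 2 0 1 0 (a.1 0) (d - a.1 0) ∈ A :=
      H.side_mem d20 d21 d01 (by omega) (by omega) (by omega)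
    have hc : expoAt 1 0 2 0 (a.1 0) (d - a.1 0) ∈ A :=
      H.side_mem d01.symm d21.symm d20.symm (by omega) (by omega) (by omega)
    have := hbin a ⟨_, hb⟩ ⟨_, hc⟩ (a.1 1) (a.1 2) (by omega) (by
      have hd : d - a.1 0 = a.1 1 + a.1 2 := by omega
      apply expo_ext
      · simp only [Finsupp.add_apply, Finsupp.smul_apply, smul_eq_mul, expoAt_snd d20 d01,
          expoAt_snd d01.symm d20.symm, hd]
        ring
      · simp only [Finsupp.add_apply, Finsupp.smul_apply, smul_eq_mul, expoAt_trd d21 d01,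
          expoAt_fst d01.symm d21.symm, hd]
        ring
      · simp only [Finsupp.add_apply, Finsupp.smul_apply, smul_eq_mul, expoAt_fst d20 d21,
          expoAt_trd d21.symm d20.symm, hd]
        ring) ha
    rcases this with hne | hne
    · exact ⟨_, hne, 2, expoAt_fst d20 d21 _ _ _⟩
    · exact ⟨_, hne, 1, expoAt_fst d01.symm d21.symm _ _ _⟩
  obtain ⟨b, hb, i, hbi⟩ := hside
  obtain ⟨j, l, hij, hil, hjl⟩ := exists_complement i
  have hdeg := H.degree_eq b.1 b.2
  rw [degree_eq_add_at hij hil hjl] at hdeg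
  have hj := H.add_le b.1 b.2 j
  have hl := H.add_le b.1 b.2 l
  have hlt := H.add_lt j l hjl
  -- `b` divides the side `x_i = 0` of the hexagon, of length `p + q = d - h j - h l > 0`, in the
  -- ratio given by `p` and `q`.
  obtain ⟨p, hp⟩ : ∃ p, b.1 l = h j + p := ⟨b.1 l - h j, by omega⟩
  obtain ⟨q, hq⟩ : ∃ q, b.1 j = h l + q := ⟨b.1 j - h l, by omega⟩
  have e1 : d - h l = p + q + h j := by omega
  have e2 : d - h j = p + q + h l := by omega
  have := hbin b ⟨_, H.vertex_mem hij hil hjl⟩ ⟨_, H.vertex_mem hil hij hjl.symm⟩ p q (by omega) (by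
    simp only [e1, e2]
    apply ext_at hij hil hjl
    · simp only [Finsupp.add_apply, Finsupp.smul_apply, smul_eq_mul, expoAt_fst hij hil,
        expoAt_fst hil hij, hbi, mul_zero, add_zero]
    · simp only [Finsupp.add_apply, Finsupp.smul_apply, smul_eq_mul, expoAt_snd hij hjl,
        expoAt_trd hij hjl.symm, hq]
      ring
    · simp only [Finsupp.add_apply, Finsupp.smul_apply, smul_eq_mul, expoAt_trd hil hjl,
        expoAt_snd hil hjl.symm, hp]
      ring) hb
  rcases this with hne | hne
  · exact ⟨_, _, _, hij, hil, hjl, hne⟩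
  · exact ⟨_, _, _, hil, hij, hjl.symm, hne⟩

theorem isSmoothToric [IsAlgClosed k] (H : IsHexagon d h A) : IsSmoothToric k A := by
  have : Infinite k := IsAlgClosed.instInfinite
  refine isSmoothToric_of_charts fun y hy hy0 => ?_
  obtain ⟨i, j, l, hij, hil, hjl, hne⟩ := H.exists_chart_ne_zero hy hy0
  exact ⟨_, _, _, H.isChart hij hil hjl, hne⟩

end IsHexagon

/-! ### Smoothness of the explicit systems -/

theorem mem_apolarExponents {S : Finset (Fin (2 + 1) →₀ ℕ)} {d : ℕ} (hS : ∀ a ∈ S, a.degree = d)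
    {a : Fin (2 + 1) →₀ ℕ} :
    a ∈ apolarExponents d (monomialIdeal k S) ↔ a.degree = d ∧ a ∉ S := by
  simp only [apolarExponents, Finset.mem_filter, Finset.mem_finsuppAntidiag, Finset.subset_univ,
    and_true, ← Finsupp.degree_eq_sum]
  exact and_congr_right fun ha => not_congr (monomial_mem_monomialIdeal_iff hS ha)

theorem forall_fin_three (P : Fin (2 + 1) → Prop) : (∀ i, P i) ↔ P 0 ∧ P 1 ∧ P 2 :=
  Fin.forall_fin_succ.trans (and_congr Iff.rfl Fin.forall_fin_two)

/-- The corner exponents are exactly the lattice points cut off: `a 0 ≥ d - 1` gives three of them,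
`a 1 = d` and `a 2 = d` one each. -/
theorem notMem_cornerExponents_iff {d : ℕ} (hd : 4 ≤ d) {a : Fin (2 + 1) →₀ ℕ}
    (ha : a.degree = d) : a ∉ cornerExponents d ↔ ∀ i, a i + ![2, 1, 1] i ≤ d := by
  rw [forall_fin_three]
  rw [degree_eq_add] at ha
  rw [eq_expo a]
  simp only [cornerExponents, pureExponents, Finset.mem_insert, Finset.mem_singleton, expo_inj,
    expo_zero, expo_one, expo_two, Matrix.cons_val]
  omega

theorem isHexagon_cornerExponents {d : ℕ} (hd : 4 ≤ d) :
    IsHexagon d ![2, 1, 1] (apolarExponents d (monomialIdeal k (cornerExponents d))) := by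
  have hmem : ∀ {a}, a ∈ apolarExponents d (monomialIdeal k (cornerExponents d)) ↔
      a.degree = d ∧ a ∉ cornerExponents d :=
    mem_apolarExponents fun a ha => degree_of_mem_cornerExponents (by omega) ha
  have hh : ∀ i, (![2, 1, 1] : Fin (2 + 1) → ℕ) i = if i = 0 then 2 else 1 := by decide
  refine ⟨fun a ha => (hmem.1 ha).1, fun a ha => ?_, fun a ha hle _ => ?_, ?_, ?_, ?_, rfl, rfl⟩
  · obtain ⟨h1, h2⟩ := hmem.1 ha
    exact (notMem_cornerExponents_iff hd h1).1 h2
  · exact hmem.2 ⟨ha, (notMem_cornerExponents_iff hd ha).2 hle⟩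
  · intro i j l hij hil hjl
    have hdeg : (expoAt i j l 1 ((![2, 1, 1] : Fin (2 + 1) → ℕ) l - 1)
        (d - (![2, 1, 1] : Fin (2 + 1) → ℕ) l)).degree = d := by
      rw [degree_eq_add_at hij hil hjl, expoAt_fst hij hil, expoAt_snd hij hjl,
        expoAt_trd hil hjl, hh]
      split_ifs <;> omega
    refine hmem.2 ⟨hdeg, (notMem_cornerExponents_iff hd hdeg).2 fun t => ?_⟩
    rcases eq_or_eq_or_eq hij hil hjl t with rfl | rfl | rfl
    · rw [expoAt_fst hij hil, hh]
      split_ifs <;> omega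
    · rw [expoAt_snd hij hjl, hh, hh]
      split_ifs <;> omega
    · rw [expoAt_trd hil hjl, hh]
      split_ifs <;> omega
  · intro i
    rw [hh]
    split_ifs <;> omega
  · intro i j hij
    rw [hh, hh]
    split_ifs with h1 h2
    · exact absurd (h1.trans h2.symm) hij
    all_goals omega

/-- Apart from the pure powers, the removed exponents are interior to the triangle, while the
hexagon axioms only ask for exponents on its sides when every `h i` is 1. -/
theorem isHexagon_stripExponents {e m : ℕ} (hm : 0 < m) (he : 2 ≤ e) :
    IsHexagon (e + m + 2) (fun _ => 1)
      (apolarExponents (e + m + 2) (monomialIdeal k (stripExponents e m))) := by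
  have hmem : ∀ {a}, a ∈ apolarExponents (e + m + 2) (monomialIdeal k (stripExponents e m)) ↔
      a.degree = e + m + 2 ∧ a ∉ stripExponents e m :=
    mem_apolarExponents fun a ha => degree_of_mem_stripExponents ha
  have hside : ∀ a : Fin (2 + 1) →₀ ℕ, a.degree = e + m + 2 → (∀ i, a i + 1 ≤ e + m + 2) →
      (∃ i, a i = 0) →
        a ∈ apolarExponents (e + m + 2) (monomialIdeal k (stripExponents e m)) := by
    intro a ha hle ⟨i, hi⟩
    refine hmem.2 ⟨ha, fun hmemS => ?_⟩
    rw [stripExponents, Finset.mem_union, mem_innerExponents] at hmemS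
    rcases hmemS with (rfl | ⟨t, ht, rfl⟩) | hp
    · exact absurd hi ((forall_fin_three fun i => expo e 1 (1 + m) i ≠ 0).2
        ⟨by simp; omega, by simp, by simp⟩ i)
    · exact absurd hi ((forall_fin_three fun i => expo (e + (m - t)) (1 + t) 1 i ≠ 0).2
        ⟨by simp; omega, by simp, by simp⟩ i)
    · have h0 := hle 0
      have h1 := hle 1
      have h2 := hle 2
      simp only [pureExponents, Finset.mem_insert, Finset.mem_singleton] at hp
      rcases hp with rfl | rfl | rfl <;> simp at h0 h1 h2
  refine ⟨fun a ha => (hmem.1 ha).1, fun a ha i => ?_, hside, ?_, fun _ => le_rfl,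
    fun _ _ _ => by omega, rfl, rfl⟩
  · obtain ⟨hdeg, hnot⟩ := hmem.1 ha
    have hp : a ∉ pureExponents (e + m + 2) := fun h => hnot (Finset.mem_union_right _ h)
    rw [eq_expo a] at hp
    simp only [pureExponents, Finset.mem_insert, Finset.mem_singleton, expo_inj] at hp
    rw [degree_eq_add] at hdeg
    exact (forall_fin_three fun i => a i + 1 ≤ e + m + 2).2
      ⟨by omega, by omega, by omega⟩ i
  · intro i j l hij hil hjl
    -- The middle entry is `1 - 1 = 0`, so the adjacent exponent also lies on a side.
    refine hside _ ?_ (fun t => ?_) ⟨j, expoAt_snd hij hjl _ _ _⟩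
    · rw [degree_eq_add_at hij hil hjl, expoAt_fst hij hil, expoAt_snd hij hjl,
        expoAt_trd hil hjl]
      omega
    · rcases eq_or_eq_or_eq hij hil hjl t with rfl | rfl | rfl
      · rw [expoAt_fst hij hil]
        omega
      · rw [expoAt_snd hij hjl]
        omega
      · rw [expoAt_trd hil hjl]
        omega

/-! ### The bounds and the explicit systems -/

theorem five_le_numGens [CharZero k] {d : ℕ} (hd : 4 ≤ d)
    {I : Ideal (MvPolynomial (Fin (2 + 1)) k)} (hI : I ∈ systems k 2 d) : 5 ≤ numGens I := by
  obtain ⟨S, hS, rfl, hTog, -⟩ := hI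
  rw [numGens_monomialIdeal hS]
  exact five_le_card_of_isTogliatti hd hS hTog

theorem numGens_le {d : ℕ} {I : Ideal (MvPolynomial (Fin (2 + 1)) k)} (hI : I ∈ systems k 2 d) :
    numGens I ≤ d + 1 := by
  obtain ⟨S, -, -, ⟨⟨r, F, hr, -, hF⟩, -, -⟩, -⟩ := hI
  rw [hF, numGens]
  refine (Submodule.spanFinrank_span_le_ncard_of_finite (Set.finite_range F)).trans ?_
  rw [← Set.image_univ]
  refine (Set.ncard_image_le Set.finite_univ).trans ?_
  simpa [Set.ncard_univ, add_comm 2 d] using hr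

theorem explicitIdeal_mem [IsAlgClosed k] [CharZero k] {d r : ℕ} (hd : 4 ≤ d) (hr : 5 ≤ r)
    (hrd : r ≤ d + 1) :
    explicitIdeal k d r ∈ smoothSystems k 2 d ∧ numGens (explicitIdeal k d r) = r := by
  rcases hr.eq_or_lt with rfl | hr
  · rw [explicitIdeal_five]
    refine ⟨⟨isMinimalMonomialTogliatti_cornerExponents hd,
      (isHexagon_cornerExponents hd).isSmoothToric⟩, ?_⟩
    rw [numGens_monomialIdeal fun a ha => degree_of_mem_cornerExponents (by omega : 0 < d) ha,
      card_cornerExponents (by omega)]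
  · obtain ⟨m, rfl⟩ : ∃ m, r = m + 5 := ⟨r - 5, by omega⟩
    -- Here `e = d - r + 3`, so `r ≤ d + 1` is the condition `e ≥ 2`.
    obtain ⟨e, rfl⟩ : ∃ e, d = e + m + 2 := ⟨d - m - 2, by omega⟩
    have hm : 0 < m := by omega
    have he : 2 ≤ e := by omega
    rw [explicitIdeal_strip hm]
    refine ⟨⟨isMinimalMonomialTogliatti_stripExponents hm he,
      (isHexagon_stripExponents hm he).isSmoothToric⟩, ?_⟩
    rw [numGens_monomialIdeal fun a ha => degree_of_mem_stripExponents ha,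
      card_stripExponents hm]

end Togliatti

end

theorem proposition4p1 {k : Type*} [Field k] [IsAlgClosed k] [CharZero k] (d : ℕ) (hd : 4 ≤ d) :
    (IsLeast (Togliatti.numGens '' Togliatti.smoothSystems k 2 d) 5 ∧
      IsLeast (Togliatti.numGens '' Togliatti.systems k 2 d) 5) ∧
    (IsGreatest (Togliatti.numGens '' Togliatti.smoothSystems k 2 d) (d + 1) ∧
      IsGreatest (Togliatti.numGens '' Togliatti.systems k 2 d) (d + 1)) ∧
    ∀ r : ℕ, 5 ≤ r → r ≤ d + 1 →
      Togliatti.explicitIdeal k d r ∈ Togliatti.smoothSystems k 2 d ∧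
        Togliatti.numGens (Togliatti.explicitIdeal k d r) = r := by
  have hmem : ∀ r : ℕ, 5 ≤ r → r ≤ d + 1 →
      Togliatti.explicitIdeal k d r ∈ Togliatti.smoothSystems k 2 d ∧
        Togliatti.numGens (Togliatti.explicitIdeal k d r) = r :=
    fun r hr hrd => Togliatti.explicitIdeal_mem hd hr hrd
  obtain ⟨h5, h5'⟩ := hmem 5 le_rfl (by omega)
  obtain ⟨hd1, hd1'⟩ := hmem (d + 1) (by omega) le_rfl
  refine ⟨⟨⟨⟨_, h5, h5'⟩, ?_⟩, ⟨⟨_, h5.1, h5'⟩, ?_⟩⟩,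
    ⟨⟨⟨_, hd1, hd1'⟩, ?_⟩, ⟨⟨_, hd1.1, hd1'⟩, ?_⟩⟩, hmem⟩
  · rintro _ ⟨I, hI, rfl⟩
    exact Togliatti.five_le_numGens hd hI.1
  · rintro _ ⟨I, hI, rfl⟩
    exact Togliatti.five_le_numGens hd hI
  · rintro _ ⟨I, hI, rfl⟩
    exact Togliatti.numGens_le hI.1
  · rintro _ ⟨I, hI, rfl⟩
    exact Togliatti.numGens_le hI
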